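/- Let $\Gamma$ be a lattice in $G=\mathrm{SL}(2,\mathbb{R})$ (a discrete subgroup with a fundamental domain of finite Haar measure), let $X=\Gamma\backslash G$, let $\mu_G$ be the $G$-invariant Borel probability measure on $X$, and let $$\eta_t(\Gamma x)=\Gamma x u^t,\qquad u^t=\begin{bmatrix}1&0\\ t&1\end{bmatrix}\qquad(t\in\mathbb{R})$$ be the horocycle flow on $X$. Let $\hat\mu$ be an ergodic self-joining of $\eta_t$, that is, a probability measure on $X\times X$ that is invariant and ergodic under the diagonal flow $\eta_t\times\eta_t$ and whose projection to each factor is $\mu_G$. Then either 1. $\hat\mu$ is the product joining $\mu_G\times\mu_G$, or 2. $\hat\mu$ has finite fibers: there is a $\hat\mu$-conull Borel set $\Omega\subseteq X\times X$ such that $(\{x\}\times X)\cap\Omega$ and $(X\times\{x\})\cap\Omega$ are finite for every $x\in X$. More precisely, let $\xi_t(x,y)=(x,\eta_t(y))$ be the vertical flow on $X\times X$. If $\hat\mu$ is invariant under $\xi_t$ for all $t\in\mathbb{R}$, then (1) holds; if it is not, then (2) holds. -/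

import Mathlib

noncomputable section

namespace Horocycle

open MeasureTheory MeasureTheory.Measure
open scoped ENNReal

/-- The group `SL(2,ℝ)`, with the topology inherited from the `2 × 2` real matrices. -/
abbrev G : Type := Matrix.SpecialLinearGroup (Fin 2) ℝ

/-- `SL(2,ℝ)` carries its Borel `σ`-algebra. -/
instance : MeasurableSpace G := borel G

instance : BorelSpace G := ⟨rfl⟩

instance : LocallyCompactSpace (Matrix (Fin 2) (Fin 2) ℝ) :=
  inferInstanceAs (LocallyCompactSpace (Fin 2 → Fin 2 → ℝ))

instance : LocallyCompactSpace G :=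
  Matrix.SpecialLinearGroup.isClosedEmbedding_val.locallyCompactSpace

instance : SecondCountableTopology (Matrix (Fin 2) (Fin 2) ℝ) :=
  inferInstanceAs (SecondCountableTopology (Fin 2 → Fin 2 → ℝ))

instance : SecondCountableTopology G :=
  Matrix.SpecialLinearGroup.isClosedEmbedding_val.isEmbedding.secondCountableTopology

/-- The unipotent one-parameter subgroup `u^t = [1, 0; t, 1]`. -/
def u (t : ℝ) : G := ⟨!![1, 0; t, 1], by simp [Matrix.det_fin_two]⟩

/-- `Γ` is a lattice in `SL(2,ℝ)`: it is discrete, and it has a fundamental domain (for its action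
on `SL(2,ℝ)` by left translations) of finite Haar measure. -/
structure IsLattice (Γ : Subgroup G) : Prop where
  discrete : DiscreteTopology Γ
  exists_fundamentalDomain :
    ∃ F : Set G, IsFundamentalDomain Γ F (haar : Measure G) ∧ (haar : Measure G) F < ∞

/-- The space `Γ \ SL(2,ℝ)` of right cosets `Γ x`. -/
def X (Γ : Subgroup G) : Type := Quotient (QuotientGroup.rightRel Γ)

variable {Γ : Subgroup G}

/-- The quotient map `x ↦ Γ x`. -/
def mk (Γ : Subgroup G) (x : G) : X Γ := Quotient.mk (QuotientGroup.rightRel Γ) x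

/-- `Γ \ SL(2,ℝ)` carries the quotient topology. -/
instance : TopologicalSpace (X Γ) :=
  inferInstanceAs (TopologicalSpace (Quotient (QuotientGroup.rightRel Γ)))

/-- `Γ \ SL(2,ℝ)` carries its Borel `σ`-algebra. -/
instance : MeasurableSpace (X Γ) := borel (X Γ)

instance : BorelSpace (X Γ) := ⟨rfl⟩

/-- Right translation `Γ x ↦ Γ x g` on `Γ \ SL(2,ℝ)`. -/
def translate (Γ : Subgroup G) (g : G) : X Γ → X Γ :=
  Quotient.map (· * g) fun a b h => by
    change QuotientGroup.rightRel Γ _ _ at h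
    change QuotientGroup.rightRel Γ _ _
    rw [QuotientGroup.rightRel_apply] at h ⊢
    simpa [mul_assoc] using h

/-- The horocycle flow `η_t (Γ x) = Γ x u^t`. -/
def horocycleFlow (Γ : Subgroup G) (t : ℝ) : X Γ → X Γ := translate Γ (u t)

/-- The `G`-invariant probability measure `μ_G` on `Γ \ SL(2,ℝ)`, for a lattice `Γ`: restrict Haar
measure on `SL(2,ℝ)` to a fundamental domain, push it forward to `Γ \ SL(2,ℝ)`, and normalize. The
result does not depend on the fundamental domain (`haarProb_eq`), it is a probability measure
(`isProbabilityMeasure_haarProb`), and it is invariant under all right translations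
(`measurePreserving_translate`). -/
def haarProb (hΓ : IsLattice Γ) : Measure (X Γ) :=
  ((haar : Measure G) hΓ.exists_fundamentalDomain.choose)⁻¹ •
    ((haar : Measure G).restrict hΓ.exists_fundamentalDomain.choose).map (mk Γ)

lemma continuous_mk : Continuous (mk Γ) := continuous_quotient_mk'

lemma measurable_mk : Measurable (mk Γ) := continuous_mk.measurable

lemma mk_smul (γ : Γ) (x : G) : mk Γ (γ • x) = mk Γ x :=
  Quotient.sound <| by
    change QuotientGroup.rightRel Γ _ _
    rw [QuotientGroup.rightRel_apply]
    simp [Subgroup.smul_def]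

lemma continuous_translate (g : G) : Continuous (translate Γ g) :=
  Continuous.quotient_map' (continuous_mul_const g) _

lemma countable_of_isLattice (hΓ : IsLattice Γ) : Countable Γ :=
  have := hΓ.discrete
  countable_of_Lindelof_of_discrete

lemma haarProb_eq (hΓ : IsLattice Γ) {F : Set G}
    (hF : IsFundamentalDomain Γ F (haar : Measure G)) :
    haarProb hΓ = ((haar : Measure G) F)⁻¹ • ((haar : Measure G).restrict F).map (mk Γ) := by
  have := countable_of_isLattice hΓ
  have h0 := hΓ.exists_fundamentalDomain.choose_spec.1
  rw [haarProb, h0.measure_eq hF]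
  congr 1
  ext s hs
  rw [map_apply measurable_mk hs, map_apply measurable_mk hs,
    restrict_apply (measurable_mk hs), restrict_apply (measurable_mk hs)]
  refine h0.measure_set_eq hF (measurable_mk hs) fun γ => ?_
  ext x
  simp only [Set.mem_preimage, mk_smul]

instance isProbabilityMeasure_haarProb (hΓ : IsLattice Γ) :
    IsProbabilityMeasure (haarProb hΓ) := by
  have := countable_of_isLattice hΓ
  have h0 := hΓ.exists_fundamentalDomain.choose_spec
  refine ⟨?_⟩
  rw [haarProb, Measure.smul_apply, map_apply measurable_mk MeasurableSet.univ]
  simp only [Set.preimage_univ, restrict_apply, MeasurableSet.univ, Set.univ_inter, smul_eq_mul]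
  exact ENNReal.inv_mul_cancel (h0.1.measure_ne_zero (NeZero.ne _)) h0.2.ne

lemma isFundamentalDomain_preimage {F : Set G} (hF : IsFundamentalDomain Γ F (haar : Measure G))
    (g : G) : IsFundamentalDomain Γ ((· * g) ⁻¹' F) (haar : Measure G) := by
  refine hF.preimage_of_equiv (quasiMeasurePreserving_mul_right _ g) (e := id)
    Function.bijective_id fun γ x => ?_
  simp [Subgroup.smul_def, mul_assoc]

/-- Since `SL(2,ℝ)` contains a lattice, its Haar measure is invariant under right translations. -/
lemma map_mul_right_haar (hΓ : IsLattice Γ) (g : G) :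
    (haar : Measure G).map (· * g) = haar := by
  have := countable_of_isLattice hΓ
  obtain ⟨F, hF, hfin⟩ := hΓ.exists_fundamentalDomain
  have h1 := isMulLeftInvariant_eq_smul ((haar : Measure G).map (· * g)) haar
  set c := haarScalarFactor ((haar : Measure G).map (· * g)) haar
  have h2 : (haar : Measure G) F = ((haar : Measure G).map (· * g)) F := by
    exact (hF.measure_eq (isFundamentalDomain_preimage hF g)).trans
      ((MeasurableEquiv.mulRight g).measurableEmbedding.map_apply _ _).symm
  have h0 : (haar : Measure G) F ≠ 0 := hF.measure_ne_zero (NeZero.ne _)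
  rw [h1] at h2 ⊢
  have h3 : (c : ℝ≥0∞) = 1 := by
    have h4 : (1 : ℝ≥0∞) * haar F = c * haar F := by simpa using h2
    exact ((ENNReal.mul_left_inj h0 hfin.ne).1 h4).symm
  rw [ENNReal.coe_eq_one.1 h3, one_smul]

lemma measurePreserving_translate (hΓ : IsLattice Γ) (g : G) :
    MeasurePreserving (translate Γ g) (haarProb hΓ) (haarProb hΓ) := by
  obtain ⟨F, hF, -⟩ := hΓ.exists_fundamentalDomain
  refine ⟨(continuous_translate g).measurable, ?_⟩
  have hR := map_mul_right_haar hΓ g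
  have he := (MeasurableEquiv.mulRight g).measurableEmbedding
  have hm : (haar : Measure G) ((· * g) ⁻¹' F) = haar F := by
    conv_rhs => rw [← hR]
    exact (he.map_apply _ _).symm
  have hr : ((haar : Measure G).restrict ((· * g) ⁻¹' F)).map (· * g) = haar.restrict F := by
    conv_rhs => rw [← hR]
    exact (he.restrict_map _ _).symm
  have hc : translate Γ g ∘ mk Γ = mk Γ ∘ (· * g) := rfl
  conv_lhs => rw [haarProb_eq hΓ (isFundamentalDomain_preimage hF g)]
  rw [haarProb_eq hΓ hF, Measure.map_smul,
    map_map (continuous_translate g).measurable measurable_mk, hc,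
    ← map_map measurable_mk (measurable_mul_const g), hr, hm]

/-- The measure `μ` is invariant and ergodic under the flow `φ`: every measurable set which is
invariant under the flow has measure `0` or `1`. -/
structure IsErgodicFlow {Y : Type*} [MeasurableSpace Y] (φ : ℝ → Y → Y) (μ : Measure Y) :
    Prop where
  invariant : ∀ t, MeasurePreserving (φ t) μ μ
  zero_or_one : ∀ A : Set Y, MeasurableSet A → (∀ t, φ t ⁻¹' A = A) → μ A = 0 ∨ μ A = 1

/-- The diagonal flow `η_t × η_t` on `X × X`. -/
def diagonalFlow (Γ : Subgroup G) (t : ℝ) : X Γ × X Γ → X Γ × X Γ :=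
  Prod.map (horocycleFlow Γ t) (horocycleFlow Γ t)

/-- The vertical flow `ξ_t (x, y) = (x, η_t y)` on `X × X`. -/
def verticalFlow (Γ : Subgroup G) (t : ℝ) : X Γ × X Γ → X Γ × X Γ :=
  Prod.map id (horocycleFlow Γ t)

/-- A self-joining of the horocycle flow on `X = Γ \ SL(2,ℝ)`: a probability measure on `X × X`
that is invariant under the diagonal flow and projects to `μ_G` on each factor. -/
structure IsSelfJoining (hΓ : IsLattice Γ) (μ : Measure (X Γ × X Γ)) : Prop where
  isProbabilityMeasure : IsProbabilityMeasure μ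
  invariant : ∀ t, MeasurePreserving (diagonalFlow Γ t) μ μ
  map_fst : μ.map Prod.fst = haarProb hΓ
  map_snd : μ.map Prod.snd = haarProb hΓ

/-- The measure `μ` on `X × X` has finite fibers: some `μ`-conull set meets each vertical line
`{x} × X` and each horizontal line `X × {x}` in a finite set. -/
def HasFiniteFibers (μ : Measure (X Γ × X Γ)) : Prop :=
  ∃ Ω : Set (X Γ × X Γ), MeasurableSet Ω ∧ μ Ωᶜ = 0 ∧
    ∀ x : X Γ, {y : X Γ | (x, y) ∈ Ω}.Finite ∧ {y : X Γ | (y, x) ∈ Ω}.Finite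

end Horocycle

end

/-! If the joining is invariant under the vertical flow, averaging `1_A(x) 1_B(y)` along vertical
orbits preserves its integral. The horocycle flow on a factor inherits ergodicity from the joining,
so these averages converge to `1_A(x)` times the Haar measure of `B`, and the joining is the product
(`measureReal_prod_eq`).

Otherwise some compactly supported `f` and some `s` satisfy `∫ f ≠ ∫ f ∘ ξ_s`. Ratner's polynomial
divergence then applies. Under the diagonal flow, a vertical displacement `g` between two points of
a fibre becomes `u^{-t} g u^t`, whose fastest-growing entry is the lower-left one, a quadratic
polynomial in `t` (`diagonalFlow_translateSnd`, `conj_u_entries`). If `g` is near `1` and this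
polynomial is not constant, then at a late time `T` the displacement is close to `u^{±s}`, and it
stays so on a window of length proportional to `T`. For points uniformly generic for `f` and `f ∘
ξ_s`, the two different means would then have to be close, so `g` must be some `u^c`
(`eventually_eq_u`). If both points are generic for vertical translates of `f`, then `c` is a period
of the nonconstant continuous function `r ↦ ∫ f ∘ ξ_r`, so a small `c` is `0`.

Hence a set of positive measure over a compact part of `X` has uniformly separated, and so boundedly
many, points in each fibre. Counting visits of generic points to this set makes almost every fibre
finite (`exists_finite_fibers_of_card_le`). Swapping the coordinates treats the other factor. -/

noncomputable section

namespace Horocycle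

open MeasureTheory Filter Topology
open scoped Pointwise ENNReal

/-! ### Maximal inequality and pointwise ergodic theorem for flows. -/

section ErgodicTheory

variable {Y : Type*}

/-- The maximum of `0` and the first `n` Birkhoff sums of `F` along `T`. -/
def maxBirkhoffSum (T : Y → Y) (F : Y → ℝ) : ℕ → Y → ℝ
  | 0, _ => 0
  | n + 1, y => max 0 (F y + maxBirkhoffSum T F n (T y))

lemma maxBirkhoffSum_nonneg (T : Y → Y) (F : Y → ℝ) (n : ℕ) (y : Y) :
    0 ≤ maxBirkhoffSum T F n y := by
  cases n with
  | zero => exact le_rfl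
  | succ n => exact le_max_left _ _

lemma maxBirkhoffSum_le_succ (T : Y → Y) (F : Y → ℝ) (n : ℕ) (y : Y) :
    maxBirkhoffSum T F n y ≤ maxBirkhoffSum T F (n + 1) y := by
  induction n generalizing y with
  | zero => exact maxBirkhoffSum_nonneg T F 1 y
  | succ n ih => exact max_le_max le_rfl (add_le_add le_rfl (ih _))

lemma birkhoffSum_le_maxBirkhoffSum (T : Y → Y) (F : Y → ℝ) (n : ℕ) (y : Y) :
    birkhoffSum T F n y ≤ maxBirkhoffSum T F n y := by
  induction n generalizing y with
  | zero => simp [maxBirkhoffSum]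
  | succ n ih =>
    rw [birkhoffSum_succ']
    exact (add_le_add le_rfl (ih _)).trans (le_max_right _ _)

variable {φ : ℝ → Y → Y} {f : Y → ℝ} {C : ℝ}

lemma abs_intervalIntegral_orbit_le (hC : ∀ y, |f y| ≤ C) (y : Y) (a b : ℝ) :
    |∫ t in a..b, f (φ t y)| ≤ C * |b - a| := by
  rw [← Real.norm_eq_abs (∫ t in a..b, f (φ t y))]
  exact intervalIntegral.norm_integral_le_of_norm_le_const fun t _ => hC _

variable [MeasurableSpace Y]

lemma measurable_maxBirkhoffSum {T : Y → Y} {F : Y → ℝ} (hT : Measurable T) (hF : Measurable F)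
    (n : ℕ) : Measurable (maxBirkhoffSum T F n) := by
  induction n with
  | zero => exact measurable_const
  | succ n ih => exact measurable_const.max (hF.add (ih.comp hT))

lemma integrable_maxBirkhoffSum {μ : Measure Y} {T : Y → Y} {F : Y → ℝ}
    (hT : MeasurePreserving T μ μ) (hF : Integrable F μ) (n : ℕ) :
    Integrable (maxBirkhoffSum T F n) μ := by
  induction n with
  | zero => exact integrable_zero _ _ _
  | succ n ih => exact (integrable_zero _ _ _).sup (hF.add (hT.integrable_comp_of_integrable ih))

/-- The maximal ergodic inequality. -/
lemma setIntegral_maxBirkhoffSum_pos_nonneg {μ : Measure Y} {T : Y → Y} {F : Y → ℝ}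
    (hT : MeasurePreserving T μ μ) (hFm : Measurable F) (hF : Integrable F μ) (n : ℕ) :
    0 ≤ ∫ y in {y | 0 < maxBirkhoffSum T F n y}, F y ∂μ := by
  cases n with
  | zero => simp [maxBirkhoffSum]
  | succ n =>
    set M := maxBirkhoffSum T F
    set A := {y | 0 < M (n + 1) y}
    have hA : MeasurableSet A :=
      measurableSet_lt measurable_const (measurable_maxBirkhoffSum hT.measurable hFm _)
    have hi := integrable_maxBirkhoffSum hT hF
    have hiT : Integrable (fun y => M n (T y)) μ := hT.integrable_comp_of_integrable (hi n)
    -- Garsia's argument: where the maximum is positive it is attained by the second term of the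
    -- recursion, so `F` is a difference of maxima there.
    have h1 : ∫ y in A, F y ∂μ = ∫ y in A, (M (n + 1) y - M n (T y)) ∂μ := by
      refine setIntegral_congr_fun hA fun y hy => ?_
      have hy' : 0 < max 0 (F y + M n (T y)) := hy
      have h2 : M (n + 1) y = F y + M n (T y) :=
        max_eq_right ((lt_max_iff.1 hy').resolve_left (lt_irrefl _)).le
      simp only [h2, add_sub_cancel_right]
    rw [h1, integral_sub (hi _).integrableOn hiT.integrableOn]
    have h2 : ∫ y in A, M (n + 1) y ∂μ = ∫ y, M (n + 1) y ∂μ :=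
      setIntegral_eq_integral_of_forall_compl_eq_zero fun y hy =>
        le_antisymm (not_lt.1 hy) (maxBirkhoffSum_nonneg _ _ _ _)
    have h3 : ∫ y in A, M n (T y) ∂μ ≤ ∫ y, M n (T y) ∂μ :=
      setIntegral_le_integral hiT (ae_of_all _ fun y => maxBirkhoffSum_nonneg _ _ _ _)
    have h4 : ∫ y, M n (T y) ∂μ = ∫ y, M n y ∂μ := by
      conv_rhs => rw [← hT.map_eq]
      rw [integral_map hT.measurable.aemeasurable]
      exact (measurable_maxBirkhoffSum hT.measurable hFm n).aestronglyMeasurable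
    have h5 : ∫ y, M n y ∂μ ≤ ∫ y, M (n + 1) y ∂μ :=
      integral_mono (hi _) (hi _) fun y => maxBirkhoffSum_le_succ _ _ _ _
    linarith

lemma integral_nonneg_of_ae_exists_birkhoffSum_pos {μ : Measure Y} {T : Y → Y} {F : Y → ℝ}
    (hT : MeasurePreserving T μ μ) (hFm : Measurable F) (hF : Integrable F μ)
    (h : ∀ᵐ y ∂μ, ∃ n, 0 < birkhoffSum T F n y) : 0 ≤ ∫ y, F y ∂μ := by
  set A : ℕ → Set Y := fun n => {y | 0 < maxBirkhoffSum T F n y}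
  have hA : ∀ n, MeasurableSet (A n) := fun n =>
    measurableSet_lt measurable_const (measurable_maxBirkhoffSum hT.measurable hFm _)
  have hmono : Monotone A := monotone_nat_of_le_succ fun n y hy =>
    lt_of_lt_of_le (show 0 < maxBirkhoffSum T F n y from hy) (maxBirkhoffSum_le_succ _ _ _ _)
  have h1 := tendsto_setIntegral_of_monotone (μ := μ) (f := F) hA hmono hF.integrableOn
  have h2 : ∫ y in ⋃ n, A n, F y ∂μ = ∫ y, F y ∂μ := by
    rw [setIntegral_congr_set (t := Set.univ), setIntegral_univ]
    rw [ae_eq_univ, ← mem_ae_iff]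
    filter_upwards [h] with y ⟨n, hn⟩
    exact Set.mem_iUnion.2 ⟨n, hn.trans_le (birkhoffSum_le_maxBirkhoffSum _ _ _ _)⟩
  rw [← h2]
  exact ge_of_tendsto' h1 fun n => setIntegral_maxBirkhoffSum_pos_nonneg hT hFm hF n

/-- A jointly measurable action of `ℝ`. -/
structure IsMeasurableFlow (φ : ℝ → Y → Y) : Prop where
  measurable : Measurable fun p : ℝ × Y => φ p.1 p.2
  map_zero : ∀ y, φ 0 y = y
  map_add : ∀ s t y, φ (s + t) y = φ s (φ t y)

lemma IsMeasurableFlow.measurable_apply (hφ : IsMeasurableFlow φ) (t : ℝ) : Measurable (φ t) :=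
  hφ.measurable.comp measurable_prodMk_left

lemma IsMeasurableFlow.measurable_orbit (hφ : IsMeasurableFlow φ) (y : Y) :
    Measurable fun t => φ t y :=
  hφ.measurable.comp measurable_prodMk_right

lemma IsMeasurableFlow.intervalIntegrable (hφ : IsMeasurableFlow φ) (hf : Measurable f)
    (hC : ∀ y, |f y| ≤ C) (y : Y) (a b : ℝ) :
    IntervalIntegrable (fun t => f (φ t y)) volume a b := by
  have : IsFiniteMeasure (volume.restrict (Set.uIoc a b)) := ⟨by simp [Set.uIoc]⟩
  rw [intervalIntegrable_iff]
  exact Integrable.of_bound (hf.comp (hφ.measurable_orbit y)).aestronglyMeasurable C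
    (ae_of_all _ fun t => hC _)

/-- The integral of `f` along the orbit of `y` from time `0` to time `r`. -/
def orbitIntegral (φ : ℝ → Y → Y) (f : Y → ℝ) (r : ℝ) (y : Y) : ℝ := ∫ t in 0..r, f (φ t y)

lemma orbitIntegral_flow (hφ : IsMeasurableFlow φ) (r s : ℝ) (y : Y) :
    orbitIntegral φ f r (φ s y) = ∫ t in s..(r + s), f (φ t y) := by
  simp only [orbitIntegral, ← hφ.map_add]
  rw [intervalIntegral.integral_comp_add_right (fun t => f (φ t y)), zero_add]

lemma orbitIntegral_add (hφ : IsMeasurableFlow φ) (hf : Measurable f) (hC : ∀ y, |f y| ≤ C)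
    (r s : ℝ) (y : Y) :
    orbitIntegral φ f (s + r) y = orbitIntegral φ f s y + orbitIntegral φ f r (φ s y) := by
  rw [orbitIntegral_flow hφ, orbitIntegral, orbitIntegral, add_comm s r,
    intervalIntegral.integral_add_adjacent_intervals] <;>
  exact hφ.intervalIntegrable hf hC y _ _

/-- The two orbit segments differ only in two end pieces of length `|s|`, as seen by splitting time
`r + s` in both orders. -/
lemma abs_orbitIntegral_flow_sub_le (hφ : IsMeasurableFlow φ) (hf : Measurable f)
    (hC : ∀ y, |f y| ≤ C) (r s : ℝ) (y : Y) :
    |orbitIntegral φ f r (φ s y) - orbitIntegral φ f r y| ≤ 2 * C * |s| := by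
  have h1 := orbitIntegral_add hφ hf hC r s y
  have h2 := orbitIntegral_add hφ hf hC s r y
  have h3 : |orbitIntegral φ f s (φ r y)| ≤ C * |s - 0| := abs_intervalIntegral_orbit_le hC _ _ _
  have h4 : |orbitIntegral φ f s y| ≤ C * |s - 0| := abs_intervalIntegral_orbit_le hC _ _ _
  rw [sub_zero] at h3 h4
  rw [add_comm s r, h2] at h1
  have h5 : orbitIntegral φ f r (φ s y) - orbitIntegral φ f r y
      = orbitIntegral φ f s (φ r y) - orbitIntegral φ f s y := by linarith
  rw [h5, abs_le]
  rw [abs_le] at h3 h4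
  constructor <;> linarith

lemma measurable_orbitIntegral (hφ : IsMeasurableFlow φ) (hf : Measurable f) (r : ℝ) :
    Measurable (orbitIntegral φ f r) := by
  have h : StronglyMeasurable (Function.uncurry fun (y : Y) (t : ℝ) => f (φ t y)) :=
    (hf.comp (hφ.measurable.comp measurable_swap)).stronglyMeasurable
  unfold orbitIntegral intervalIntegral
  exact (h.integral_prod_right.sub h.integral_prod_right).measurable

/-- Transfers the discrete maximal inequality to the flow. The time-one map itself need not be
ergodic. -/
lemma birkhoffSum_orbitIntegral (hφ : IsMeasurableFlow φ) (hf : Measurable f)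
    (hC : ∀ y, |f y| ≤ C) (n : ℕ) (y : Y) :
    birkhoffSum (φ 1) (orbitIntegral φ f 1) n y = orbitIntegral φ f n y := by
  induction n generalizing y with
  | zero => simp [orbitIntegral]
  | succ n ih =>
    rw [birkhoffSum_succ', ih, Nat.cast_succ, add_comm (n : ℝ) 1, ← orbitIntegral_add hφ hf hC]

lemma integral_orbitIntegral {μ : Measure Y} [IsProbabilityMeasure μ] (hφ : IsMeasurableFlow φ)
    (hinv : ∀ t, MeasurePreserving (φ t) μ μ) (hf : Measurable f)
    (hC : ∀ y, |f y| ≤ C) (r : ℝ) : ∫ y, orbitIntegral φ f r y ∂μ = r * ∫ y, f y ∂μ := by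
  have : IsFiniteMeasure (volume.restrict (Set.uIoc 0 r)) := ⟨by simp [Set.uIoc]⟩
  have hint : Integrable (Function.uncurry fun (y : Y) (t : ℝ) => f (φ t y))
      (μ.prod (volume.restrict (Set.uIoc 0 r))) :=
    Integrable.of_bound
      (hf.comp (hφ.measurable.comp measurable_swap)).aestronglyMeasurable C
      (ae_of_all _ fun t => hC _)
  unfold orbitIntegral
  rw [← intervalIntegral_integral_swap]
  · have h : ∀ t, ∫ y, f (φ t y) ∂μ = ∫ y, f y ∂μ := fun t => by
      conv_rhs => rw [← (hinv t).map_eq]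
      rw [integral_map (hinv t).measurable.aemeasurable hf.aestronglyMeasurable]
    simp [h]
  · exact hint.swap

/-- Moving the base point costs a bounded error, which the gap `d - c` absorbs for large `N`. -/
lemma frequently_lt_orbitIntegral_flow (hφ : IsMeasurableFlow φ) (hf : Measurable f)
    (hC : ∀ y, |f y| ≤ C) {c d : ℝ} (hcd : c < d) {y : Y}
    (h : ∃ᶠ N : ℕ in atTop, d * N < orbitIntegral φ f N y) (s : ℝ) :
    ∃ᶠ N : ℕ in atTop, c * N < orbitIntegral φ f N (φ s y) := by
  have h1 : ∀ᶠ N : ℕ in atTop, 2 * C * |s| ≤ (d - c) * N :=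
    (tendsto_natCast_atTop_atTop.const_mul_atTop (sub_pos.2 hcd)).eventually_ge_atTop _
  refine (h.and_eventually h1).mono fun N hN => ?_
  have := (abs_le.1 (abs_orbitIntegral_flow_sub_le hφ hf hC N s y)).1
  nlinarith [hN.1, hN.2]

lemma ae_eventually_orbitIntegral_le {μ : Measure Y} [IsProbabilityMeasure μ]
    (hφ : IsMeasurableFlow φ) (herg : IsErgodicFlow φ μ) (hf : Measurable f)
    (hC : ∀ y, |f y| ≤ C) {c : ℝ} (hc : ∫ y, f y ∂μ < c) :
    ∀ᵐ y ∂μ, ∀ᶠ N : ℕ in atTop, orbitIntegral φ f N y ≤ c * N := by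
  obtain ⟨b, hb, hbc⟩ := exists_between hc
  -- The varying slack `1 / (k + 1)` makes `A` exactly invariant: shifting along the orbit only
  -- lowers the slack to that of `k + 1`.
  set A : Set Y := {y | ∃ k : ℕ, ∃ᶠ N : ℕ in atTop, (b + 1 / (k + 1)) * N < orbitIntegral φ f N y}
  have hAm : MeasurableSet A := by
    have : A = ⋃ k : ℕ, limsup (fun N : ℕ => {y | (b + 1 / (k + 1)) * N < orbitIntegral φ f N y})
        atTop := by
      ext y
      simp only [A, Set.mem_iUnion, mem_limsup_iff_frequently_mem, Set.mem_ofPred_eq]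
    rw [this]
    exact MeasurableSet.iUnion fun k => MeasurableSet.measurableSet_limsup fun N =>
      measurableSet_lt measurable_const (measurable_orbitIntegral hφ hf _)
  have hsub : ∀ s y, y ∈ A → φ s y ∈ A := by
    rintro s y ⟨k, hk⟩
    refine ⟨k + 1, frequently_lt_orbitIntegral_flow hφ hf hC ?_ hk s⟩
    have := Nat.one_div_lt_one_div (α := ℝ) (Nat.lt_succ_self k)
    push_cast at this ⊢
    linarith
  have hAi : ∀ s, φ s ⁻¹' A = A := fun s => by
    ext y
    refine ⟨fun h => ?_, hsub s y⟩
    have := hsub (-s) _ h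
    rwa [← hφ.map_add, neg_add_cancel, hφ.map_zero] at this
  have hA0 : μ A = 0 := by
    refine (herg.zero_or_one A hAm hAi).resolve_right fun h1 => ?_
    have hae : ∀ᵐ y ∂μ, y ∈ A := (prob_compl_eq_zero_iff hAm).2 h1
    have hbd : ∀ y, |orbitIntegral φ f 1 y| ≤ C := fun y => by
      simpa [orbitIntegral] using abs_intervalIntegral_orbit_le (φ := φ) hC y 0 1
    have hi : Integrable (orbitIntegral φ f 1) μ :=
      Integrable.of_bound (measurable_orbitIntegral hφ hf 1).aestronglyMeasurable C
        (ae_of_all _ hbd)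
    -- If `A` had full measure, the maximal inequality would give `b ≤ ∫ f`, against the choice of
    -- `b`.
    have h2 := integral_nonneg_of_ae_exists_birkhoffSum_pos (F := fun y => orbitIntegral φ f 1 y - b)
      (herg.invariant 1) ((measurable_orbitIntegral hφ hf 1).sub_const b)
      (hi.sub (integrable_const b)) (by
        filter_upwards [hae] with y ⟨k, hk⟩
        obtain ⟨N, hN⟩ := hk.exists
        refine ⟨N, ?_⟩
        have h3 : birkhoffSum (φ 1) (fun y => orbitIntegral φ f 1 y - b) N y
            = orbitIntegral φ f N y - N * b := by
          rw [← birkhoffSum_orbitIntegral hφ hf hC]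
          simp [birkhoffSum, Finset.sum_sub_distrib]
        have h4 : 0 ≤ 1 / ((k : ℝ) + 1) * N := by positivity
        rw [h3]
        linarith)
    rw [integral_sub hi (integrable_const b), integral_orbitIntegral hφ herg.invariant hf hC] at h2
    simp at h2
    linarith
  filter_upwards [measure_eq_zero_iff_ae_notMem.1 hA0] with y hy
  obtain ⟨k, hk⟩ := exists_nat_one_div_lt (sub_pos.2 hbc)
  have h5 : ∀ᶠ N : ℕ in atTop, ¬ (b + 1 / (k + 1)) * N < orbitIntegral φ f N y :=
    not_frequently.1 fun h => hy ⟨k, h⟩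
  filter_upwards [h5] with N hN
  refine (not_lt.1 hN).trans (mul_le_mul_of_nonneg_right ?_ N.cast_nonneg)
  linarith

/-- The pointwise ergodic theorem, for bounded functions and ergodic flows. -/
theorem ae_tendsto_orbitIntegral_div {μ : Measure Y} [IsProbabilityMeasure μ]
    (hφ : IsMeasurableFlow φ) (herg : IsErgodicFlow φ μ) (hf : Measurable f)
    (hC : ∀ y, |f y| ≤ C) :
    ∀ᵐ y ∂μ, Tendsto (fun N : ℕ => orbitIntegral φ f N y / N) atTop (𝓝 (∫ y, f y ∂μ)) := by
  have hpos : ∀ k : ℕ, (0 : ℝ) < 1 / (k + 1) := fun k => Nat.one_div_pos_of_nat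
  have h1 : ∀ᵐ y ∂μ, ∀ k : ℕ, ∀ᶠ N : ℕ in atTop,
      orbitIntegral φ f N y ≤ (∫ y, f y ∂μ + 1 / (k + 1)) * N :=
    ae_all_iff.2 fun k => ae_eventually_orbitIntegral_le hφ herg hf hC (by linarith [hpos k])
  have h2 : ∀ᵐ y ∂μ, ∀ k : ℕ, ∀ᶠ N : ℕ in atTop,
      orbitIntegral φ (fun y => - f y) N y ≤ (∫ y, - f y ∂μ + 1 / (k + 1)) * N :=
    ae_all_iff.2 fun k => ae_eventually_orbitIntegral_le hφ herg (f := fun y => - f y) hf.neg (C := C)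
      (fun y => by rw [abs_neg]; exact hC y) (by linarith [hpos k])
  filter_upwards [h1, h2] with y hy1 hy2
  rw [Metric.tendsto_nhds]
  intro ε hε
  obtain ⟨k, hk⟩ := exists_nat_one_div_lt hε
  filter_upwards [hy1 k, hy2 k, eventually_gt_atTop 0] with N hN1 hN2 hN
  have hN' : (0 : ℝ) < N := Nat.cast_pos.2 hN
  rw [integral_neg, orbitIntegral, intervalIntegral.integral_neg] at hN2
  change -orbitIntegral φ f N y ≤ _ at hN2
  have h3 : orbitIntegral φ f N y / N ≤ ∫ y, f y ∂μ + 1 / (k + 1) := (div_le_iff₀ hN').2 hN1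
  have h4 : ∫ y, f y ∂μ - 1 / (k + 1) ≤ orbitIntegral φ f N y / N := by
    rw [le_div_iff₀ hN']
    linarith
  rw [Real.dist_eq, abs_lt]
  constructor <;> linarith

end ErgodicTheory

/-! ### Topology of the quotient and vertical translations. -/

section HomogeneousSpace

variable {Γ : Subgroup G}

lemma isOpenQuotientMap_mk : IsOpenQuotientMap (mk Γ) :=
  MulAction.isOpenQuotientMap_quotientMk (Γ := Γ) (T := G)

instance : SecondCountableTopology (X Γ) :=
  ContinuousConstSMul.secondCountableTopology (Γ := Γ) (T := G)

instance : LocallyCompactSpace (X Γ) := isOpenQuotientMap_mk.locallyCompactSpace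

lemma t2Space_of_isLattice (hΓ : IsLattice Γ) : T2Space (X Γ) := by
  have := hΓ.discrete
  have : ProperlyDiscontinuousSMul Γ G :=
    Γ.properlyDiscontinuousSMul_of_tendsto_cofinite
      (Γ.tendsto_coe_cofinite_of_discrete (isDiscrete_iff_discreteTopology.2 this))
  exact t2Space_of_properlyDiscontinuousSMul_of_t2Space (Γ := Γ) (T := G)

lemma continuous_translate_uncurry : Continuous fun p : X Γ × G => translate Γ p.2 p.1 := by
  have h : IsOpenQuotientMap (Prod.map (mk Γ) (id : G → G)) :=
    isOpenQuotientMap_mk.prodMap .id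
  rw [← h.continuous_comp_iff]
  exact continuous_mk.comp continuous_mul

lemma mk_surjective (x : X Γ) : ∃ g, mk Γ g = x := Quotient.exists_rep x

lemma translate_mul (g h : G) (x : X Γ) :
    translate Γ (g * h) x = translate Γ h (translate Γ g x) := by
  obtain ⟨a, rfl⟩ := mk_surjective x
  exact congrArg (mk Γ) (mul_assoc a g h).symm

lemma translate_one (x : X Γ) : translate Γ 1 x = x := by
  obtain ⟨a, rfl⟩ := mk_surjective x
  exact congrArg (mk Γ) (mul_one a)

lemma u_add (s t : ℝ) : u (s + t) = u s * u t := by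
  refine Subtype.ext ?_
  change !![1, 0; s + t, 1] = !![1, 0; s, 1] * !![1, 0; t, 1]
  simp

lemma u_zero : u 0 = 1 := by
  ext i j
  fin_cases i <;> fin_cases j <;> simp [u]

lemma continuous_u : Continuous u := by
  refine Continuous.subtype_mk (continuous_matrix fun i j => ?_) _
  fin_cases i <;> fin_cases j <;> simp <;> fun_prop

/-- Right translation of the second coordinate of `X × X`. -/
def translateSnd (Γ : Subgroup G) (g : G) (p : X Γ × X Γ) : X Γ × X Γ := (p.1, translate Γ g p.2)

lemma verticalFlow_eq (t : ℝ) : verticalFlow Γ t = translateSnd Γ (u t) := rfl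

lemma continuous_translateSnd_uncurry :
    Continuous fun q : (X Γ × X Γ) × G => translateSnd Γ q.2 q.1 :=
  (continuous_fst.comp continuous_fst).prodMk
    (continuous_translate_uncurry.comp ((continuous_snd.comp continuous_fst).prodMk continuous_snd))

lemma continuous_translateSnd (g : G) : Continuous (translateSnd Γ g) :=
  continuous_translateSnd_uncurry.comp (continuous_id.prodMk continuous_const)

lemma translateSnd_mul (g h : G) (p : X Γ × X Γ) :
    translateSnd Γ (g * h) p = translateSnd Γ h (translateSnd Γ g p) := by
  simp [translateSnd, translate_mul]

lemma translateSnd_one (p : X Γ × X Γ) : translateSnd Γ 1 p = p := by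
  simp [translateSnd, translate_one]

lemma continuous_horocycleFlow_uncurry :
    Continuous fun p : ℝ × X Γ => horocycleFlow Γ p.1 p.2 :=
  continuous_translate_uncurry.comp (continuous_snd.prodMk (continuous_u.comp continuous_fst))

lemma isMeasurableFlow_horocycleFlow : IsMeasurableFlow (horocycleFlow Γ) where
  measurable := continuous_horocycleFlow_uncurry.measurable
  map_zero x := by rw [horocycleFlow, u_zero, translate_one]
  map_add s t x := by rw [add_comm, horocycleFlow, u_add, translate_mul]; rfl

lemma isMeasurableFlow_diagonalFlow : IsMeasurableFlow (diagonalFlow Γ) where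
  measurable := by
    have h := (isMeasurableFlow_horocycleFlow (Γ := Γ)).measurable
    have h1 : Measurable fun p : ℝ × X Γ × X Γ => horocycleFlow Γ p.1 p.2.1 :=
      h.comp (f := fun p : ℝ × X Γ × X Γ => (p.1, p.2.1)) (by fun_prop)
    have h2 : Measurable fun p : ℝ × X Γ × X Γ => horocycleFlow Γ p.1 p.2.2 :=
      h.comp (f := fun p : ℝ × X Γ × X Γ => (p.1, p.2.2)) (by fun_prop)
    exact h1.prodMk h2
  map_zero p := Prod.ext (isMeasurableFlow_horocycleFlow.map_zero p.1)
    (isMeasurableFlow_horocycleFlow.map_zero p.2)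
  map_add s t p := Prod.ext (isMeasurableFlow_horocycleFlow.map_add s t p.1)
    (isMeasurableFlow_horocycleFlow.map_add s t p.2)

/-- The law by which the displacement between two points of a fibre evolves. -/
lemma diagonalFlow_translateSnd (t : ℝ) (g : G) (p : X Γ × X Γ) :
    diagonalFlow Γ t (translateSnd Γ g p)
      = translateSnd Γ ((u t)⁻¹ * g * u t) (diagonalFlow Γ t p) := by
  refine Prod.ext rfl ?_
  change translate Γ (u t) (translate Γ g p.2) =
    translate Γ ((u t)⁻¹ * g * u t) (translate Γ (u t) p.2)
  rw [← translate_mul, ← translate_mul]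
  congr 1
  group

/-- Compactly supported functions vary uniformly little under small translations of the second
coordinate. -/
lemma eventually_abs_translateSnd_sub_lt {f : X Γ × X Γ → ℝ} (hf : Continuous f)
    (hs : HasCompactSupport f) {ε : ℝ} (hε : 0 < ε) :
    ∀ᶠ g in 𝓝 (1 : G), ∀ p, |f (translateSnd Γ g p) - f p| < ε := by
  obtain ⟨V, hV, hV1⟩ := exists_compact_mem_nhds (1 : G)
  have hS : IsCompact (tsupport f) := hs
  -- For `g ∈ V` and `p` outside this compact set, both values of `f` vanish, so only a compact set
  -- of points needs the tube lemma.
  set S' : Set (X Γ × X Γ) :=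
    (fun q : (X Γ × X Γ) × G => translateSnd Γ q.2⁻¹ q.1) '' (tsupport f ×ˢ V) with hS'
  have hS'c : IsCompact S' := by
    refine (hS.prod hV).image ?_
    exact continuous_translateSnd_uncurry.comp (continuous_fst.prodMk continuous_snd.inv)
  have hopen : IsOpen {q : G × (X Γ × X Γ) | |f (translateSnd Γ q.1 q.2) - f q.2| < ε} := by
    refine isOpen_lt (((hf.comp ?_).sub (hf.comp continuous_snd)).abs) continuous_const
    exact continuous_translateSnd_uncurry.comp continuous_swap
  obtain ⟨W, W', hW, -, h1W, hSW, hWW⟩ := generalized_tube_lemma (isCompact_singleton (x := (1 : G)))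
    hS'c hopen (by
      rintro ⟨g, p⟩ ⟨hg, -⟩
      simp only [Set.mem_singleton_iff] at hg
      simp [hg, translateSnd_one, hε])
  filter_upwards [hV1, hW.mem_nhds (h1W rfl)] with g hgV hgW p
  by_cases hp : p ∈ S'
  · exact hWW (Set.mk_mem_prod hgW (hSW hp))
  · have h1 : f (translateSnd Γ g p) = 0 := by
      refine image_eq_zero_of_notMem_tsupport fun h => hp ?_
      refine ⟨(translateSnd Γ g p, g), ⟨h, hgV⟩, ?_⟩
      simp [← translateSnd_mul, translateSnd_one]
    have h2 : f p = 0 := by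
      refine image_eq_zero_of_notMem_tsupport fun h => hp ?_
      refine ⟨(p, 1), ⟨h, mem_of_mem_nhds hV1⟩, ?_⟩
      simp [translateSnd_one]
    simp [h1, h2, hε]

/-- Every subset of `X × K`, with `K` compact, in which distinct points of a fibre differ by
translations bounded away from `1`, meets the fibres in a bounded number of points. -/
lemma exists_card_le_of_translateSnd_discrete {E : Set (X Γ × X Γ)} {K : Set (X Γ)}
    (hK : IsCompact K) (hEK : ∀ p ∈ E, p.2 ∈ K)
    (h : ∀ᶠ g in 𝓝 (1 : G), ∀ p ∈ E, translateSnd Γ g p ∈ E → g = 1) :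
    ∃ N : ℕ, ∀ (x : X Γ) (s : Finset (X Γ)), (∀ y ∈ s, (x, y) ∈ E) → s.card ≤ N := by
  have h2 : Tendsto (fun q : G × G => q.1⁻¹ * q.2) (𝓝 1 ×ˢ 𝓝 1) (𝓝 1) := by
    have : Continuous fun q : G × G => q.1⁻¹ * q.2 := by fun_prop
    simpa [nhds_prod_eq] using this.tendsto (1, 1)
  obtain ⟨W, hW, hWW⟩ := (eventually_prod_self_iff (r := fun g g' : G =>
    ∀ p ∈ E, translateSnd Γ (g⁻¹ * g') p ∈ E → g⁻¹ * g' = 1)).1 (h2.eventually h)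
  have hmem : ∀ y ∈ K, (fun g => translate Γ g y) '' W ∈ 𝓝 y := by
    intro y _
    obtain ⟨a, rfl⟩ := mk_surjective y
    have h3 : a • W ∈ 𝓝 a := by simpa using smul_mem_nhds_smul a hW
    have h4 := isOpenQuotientMap_mk.isOpenMap.image_mem_nhds (f := mk Γ) h3
    refine mem_of_superset h4 ?_
    rintro _ ⟨_, ⟨g, hg, rfl⟩, rfl⟩
    exact ⟨g, hg, rfl⟩
  -- Two points of a fibre of `E` in the same translate of `W` differ by an element of `W⁻¹W`, hence
  -- coincide; the size of the cover is the bound.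
  obtain ⟨t, -, ht⟩ := hK.elim_nhds_subcover _ hmem
  refine ⟨t.card, fun x s hs => ?_⟩
  have h5 : ∀ y ∈ s, ∃ z ∈ t, ∃ g ∈ W, translate Γ g z = y := fun y hy => by
    simpa using ht (hEK _ (hs y hy))
  have : Nonempty (X Γ) := ⟨x⟩
  choose! c hc using h5
  refine Finset.card_le_card_of_injOn c (fun y hy => (hc y hy).1) fun y hy y' hy' hcy => ?_
  obtain ⟨g, hg, hgy⟩ := (hc y hy).2
  obtain ⟨g', hg', hgy'⟩ := (hc y' hy').2
  have h6 : translateSnd Γ (g⁻¹ * g') (x, y) = (x, y') := by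
    refine Prod.ext rfl ?_
    change translate Γ _ y = y'
    rw [← hgy', ← hgy, ← translate_mul, hcy]
    simp
  have h7 := hWW g hg g' hg' (x, y) (hs y hy) (h6 ▸ hs y' hy')
  rw [h7, translateSnd_one] at h6
  exact congrArg Prod.snd h6

end HomogeneousSpace

/-! ### The vertically invariant case. -/

section ProductJoining

variable {Γ : Subgroup G}

lemma IsSelfJoining.isErgodicFlow_horocycleFlow {hΓ : IsLattice Γ} {μ : Measure (X Γ × X Γ)}
    (hμ : IsSelfJoining hΓ μ) (herg : IsErgodicFlow (diagonalFlow Γ) μ) :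
    IsErgodicFlow (horocycleFlow Γ) (haarProb hΓ) where
  invariant t := measurePreserving_translate hΓ (u t)
  zero_or_one A hA hinv := by
    rw [← hμ.map_fst, Measure.map_apply measurable_fst hA]
    refine herg.zero_or_one _ (measurable_fst hA) fun t => ?_
    change Prod.fst ⁻¹' (horocycleFlow Γ t ⁻¹' A) = _
    rw [hinv]

lemma isMeasurableFlow_verticalFlow : IsMeasurableFlow (verticalFlow Γ) where
  measurable := by
    have h := (isMeasurableFlow_horocycleFlow (Γ := Γ)).measurable
    have h1 : Measurable fun p : ℝ × X Γ × X Γ => p.2.1 := by fun_prop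
    have h2 : Measurable fun p : ℝ × X Γ × X Γ => horocycleFlow Γ p.1 p.2.2 :=
      h.comp (f := fun p : ℝ × X Γ × X Γ => (p.1, p.2.2)) (by fun_prop)
    exact h1.prodMk h2
  map_zero p := Prod.ext rfl (isMeasurableFlow_horocycleFlow.map_zero p.2)
  map_add s t p := Prod.ext rfl (isMeasurableFlow_horocycleFlow.map_add s t p.2)

lemma abs_indicator_one_le {Y : Type*} (A : Set Y) (y : Y) :
    |A.indicator (1 : Y → ℝ) y| ≤ 1 := by
  by_cases h : y ∈ A <;> simp [h]

lemma IsSelfJoining.measureReal_prod_eq {hΓ : IsLattice Γ} {μ : Measure (X Γ × X Γ)}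
    (hμ : IsSelfJoining hΓ μ) (herg : IsErgodicFlow (diagonalFlow Γ) μ)
    (hinv : ∀ t, MeasurePreserving (verticalFlow Γ t) μ μ) {A B : Set (X Γ)}
    (hA : MeasurableSet A) (hB : MeasurableSet B) :
    μ.real (A ×ˢ B) = (haarProb hΓ).real A * (haarProb hΓ).real B := by
  have := hμ.isProbabilityMeasure
  set iA : X Γ → ℝ := A.indicator 1
  set iB : X Γ → ℝ := B.indicator 1
  have hAm : Measurable iA := measurable_one.indicator hA
  have hBm : Measurable iB := measurable_one.indicator hB
  set f : X Γ × X Γ → ℝ := fun p => iA p.1 * iB p.2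
  have hf : Measurable f := (hAm.comp measurable_fst).mul (hBm.comp measurable_snd)
  have hf1 : ∀ p, |f p| ≤ 1 := fun p => by
    rw [abs_mul]
    exact mul_le_one₀ (abs_indicator_one_le _ _) (abs_nonneg _) (abs_indicator_one_le _ _)
  have hfi : ∫ p, f p ∂μ = μ.real (A ×ˢ B) := by
    have : f = (A ×ˢ B).indicator 1 := by
      ext p
      by_cases h1 : p.1 ∈ A <;> by_cases h2 : p.2 ∈ B <;>
        simp [f, iA, iB, h1, h2, Set.indicator, Set.mem_prod]
    rw [this, integral_indicator_one (hA.prod hB)]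
  have horb : ∀ r p, orbitIntegral (verticalFlow Γ) f r p
      = iA p.1 * orbitIntegral (horocycleFlow Γ) iB r p.2 := fun r p => by
    rw [orbitIntegral, orbitIntegral, ← intervalIntegral.integral_const_mul]
    rfl
  have hae : ∀ᵐ p ∂μ, Tendsto (fun N : ℕ => orbitIntegral (horocycleFlow Γ) iB N p.2 / N) atTop
      (𝓝 ((haarProb hΓ).real B)) := by
    have h := ae_tendsto_orbitIntegral_div isMeasurableFlow_horocycleFlow
      (hμ.isErgodicFlow_horocycleFlow herg) hBm (abs_indicator_one_le B)
    rw [integral_indicator_one hB, ← hμ.map_snd] at h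
    rw [← hμ.map_snd]
    exact ae_of_ae_map measurable_snd.aemeasurable h
  have hmO : ∀ r, Measurable (orbitIntegral (horocycleFlow Γ) iB r) :=
    measurable_orbitIntegral isMeasurableFlow_horocycleFlow hBm
  have hlim := tendsto_integral_of_dominated_convergence (μ := μ)
    (F := fun (N : ℕ) p => iA p.1 * (orbitIntegral (horocycleFlow Γ) iB N p.2 / N))
    (f := fun p => iA p.1 * (haarProb hΓ).real B) (fun _ => 1)
    (fun N => ((hAm.comp measurable_fst).mul
      (((hmO N).comp measurable_snd).div_const _)).aestronglyMeasurable)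
    (integrable_const _)
    (fun N => ae_of_all _ fun p => by
      rw [Real.norm_eq_abs, abs_mul, abs_div]
      refine mul_le_one₀ (abs_indicator_one_le _ _) (by positivity) ?_
      have h := abs_intervalIntegral_orbit_le (φ := horocycleFlow Γ)
        (abs_indicator_one_le B) p.2 0 N
      rw [one_mul, sub_zero] at h
      exact div_le_one_of_le₀ h (abs_nonneg _))
    (by filter_upwards [hae] with p hp using hp.const_mul _)
  -- Vertical invariance makes the integral of the averages independent of `N`; dominated
  -- convergence has computed its limit.
  have hconst : ∀ᶠ N : ℕ in atTop,
      ∫ p, iA p.1 * (orbitIntegral (horocycleFlow Γ) iB N p.2 / N) ∂μ = μ.real (A ×ˢ B) := by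
    filter_upwards [eventually_gt_atTop 0] with N hN
    have h := integral_orbitIntegral isMeasurableFlow_verticalFlow hinv hf hf1 N
    simp only [horb, hfi] at h
    simp only [← mul_div_assoc]
    rw [integral_div, h, mul_div_cancel_left₀]
    exact_mod_cast hN.ne'
  rw [tendsto_congr' hconst] at hlim
  rw [tendsto_nhds_unique tendsto_const_nhds hlim, integral_mul_const]
  congr 1
  rw [← integral_indicator_one hA]
  conv_rhs => rw [← hμ.map_fst]
  rw [integral_map measurable_fst.aemeasurable]
  exact hAm.aestronglyMeasurable

/-- An ergodic self-joining that is invariant under the vertical flow is the product joining. -/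
theorem IsSelfJoining.eq_prod {hΓ : IsLattice Γ} {μ : Measure (X Γ × X Γ)}
    (hμ : IsSelfJoining hΓ μ) (herg : IsErgodicFlow (diagonalFlow Γ) μ)
    (hinv : ∀ t, MeasurePreserving (verticalFlow Γ t) μ μ) :
    μ = (haarProb hΓ).prod (haarProb hΓ) := by
  have := hμ.isProbabilityMeasure
  refine (Measure.prod_eq fun A B hA hB => ?_).symm
  rw [← ENNReal.toReal_eq_toReal_iff' (by finiteness) (by finiteness), ENNReal.toReal_mul]
  exact hμ.measureReal_prod_eq herg hinv hA hB

end ProductJoining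

/-! ### Quadratic polynomials and conjugation by the unipotent subgroup. -/

section PolynomialDivergence

/-- The second difference at `0`, `T / 2`, `T` equals `-b * T ^ 2 / 2`, whence the `8`; the
difference of the end values then bounds `e * T`. -/
lemma abs_coeff_le_of_abs_quadratic_le {b c e σ T : ℝ} (hT : 0 ≤ T)
    (h : ∀ t ∈ Set.Icc 0 T, |c + e * t - b * t ^ 2| ≤ σ) :
    |b| * T ^ 2 ≤ 8 * σ ∧ |e| * T ≤ 10 * σ := by
  have h0 := abs_le.1 (h 0 ⟨le_rfl, hT⟩)
  have h1 := abs_le.1 (h (T / 2) ⟨by linarith, by linarith⟩)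
  have h2 := abs_le.1 (h T ⟨hT, le_rfl⟩)
  have hb : |b * T ^ 2| ≤ 8 * σ := by
    rw [abs_le]
    constructor <;> nlinarith [h0.1, h0.2, h1.1, h1.2, h2.1, h2.2]
  have he : |e * T| ≤ 10 * σ := by
    rw [abs_le] at hb ⊢
    constructor <;> nlinarith [h0.1, h0.2, h2.1, h2.2, hb.1, hb.2]
  rw [abs_mul, abs_of_nonneg (sq_nonneg T)] at hb
  rw [abs_mul, abs_of_nonneg hT] at he
  exact ⟨hb, he⟩

lemma exists_first_abs_quadratic_eq {b c e σ : ℝ} (hc : |c| < σ) (hbe : b ≠ 0 ∨ e ≠ 0) :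
    ∃ T, 0 < T ∧ |c + e * T - b * T ^ 2| = σ ∧
      ∀ t ∈ Set.Icc 0 T, |c + e * t - b * t ^ 2| ≤ σ := by
  set q : ℝ → ℝ := fun t => |c + e * t - b * t ^ 2|
  have hq : Continuous q := by fun_prop
  have hσ : 0 < σ := (abs_nonneg c).trans_lt hc
  have hex : ∃ t, 0 ≤ t ∧ σ ≤ q t := by
    by_contra! hcon
    have h := fun T (hT : 0 ≤ T) => abs_coeff_le_of_abs_quadratic_le (b := b) (c := c) (e := e) hT
      fun t ht => (hcon t ht.1).le
    rcases hbe with hb | he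
    · have hb' := abs_pos.2 hb
      -- This time is at least `1`, so `|b| T ^ 2 ≥ |b| T > 8 σ`, violating the coefficient bound.
      have h1 := (h (8 * σ / |b| + 1) (by positivity)).1
      have h2 : |b| * (8 * σ / |b| + 1) = 8 * σ + |b| := by field_simp
      have h3 : 0 ≤ 8 * σ / |b| := by positivity
      nlinarith
    · have he' := abs_pos.2 he
      have h1 := (h (10 * σ / |e| + 1) (by positivity)).2
      have h2 : |e| * (10 * σ / |e| + 1) = 10 * σ + |e| := by field_simp
      linarith
  set S : Set ℝ := {t | 0 ≤ t ∧ σ ≤ q t}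
  have hS : IsClosed S :=
    (isClosed_le continuous_const continuous_id).inter (isClosed_le continuous_const hq)
  have hbd : BddBelow S := ⟨0, fun t ht => ht.1⟩
  have hmem : sInf S ∈ S := hS.csInf_mem hex hbd
  set T := sInf S
  have hlt : ∀ t, 0 ≤ t → t < T → q t < σ := fun t ht htT =>
    not_le.1 fun h => (csInf_le hbd ⟨ht, h⟩).not_gt htT
  have hT : 0 < T := by
    refine lt_of_le_of_ne hmem.1 fun h0 => ?_
    have h1 : σ ≤ q T := hmem.2
    rw [← h0] at h1
    simp only [q] at h1
    norm_num at h1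
    linarith
  have hle : q T ≤ σ := by
    have h1 : Tendsto q (𝓝[<] T) (𝓝 (q T)) := hq.continuousWithinAt
    refine le_of_tendsto h1 ?_
    filter_upwards [Ioo_mem_nhdsLT hT] with t ht using (hlt t ht.1.le ht.2).le
  refine ⟨T, hT, le_antisymm hle hmem.2, fun t ht => ?_⟩
  rcases ht.2.lt_or_eq with h | h
  · exact (hlt t ht.1 h).le
  · rw [h]
    exact hle

lemma lt_of_abs_quadratic_eq {b c e σ T T₀ : ℝ} (hT : 0 ≤ T)
    (hc : |c| < σ / 3) (he : |e| * T₀ < σ / 3) (hb : |b| * T₀ ^ 2 < σ / 3)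
    (h : |c + e * T - b * T ^ 2| = σ) : T₀ < T := by
  by_contra! hle
  have h1 : |c + e * T - b * T ^ 2| ≤ |c| + |e| * T + |b| * T ^ 2 := by
    calc _ ≤ |c + e * T| + |b * T ^ 2| := abs_sub _ _
      _ ≤ |c| + |e * T| + |b * T ^ 2| := by gcongr; exact abs_add_le _ _
      _ = _ := by rw [abs_mul, abs_mul, abs_of_nonneg hT, abs_of_nonneg (sq_nonneg T)]
  have h2 : |e| * T ≤ |e| * T₀ := by gcongr
  have h3 : |b| * T ^ 2 ≤ |b| * T₀ ^ 2 := by gcongr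
  linarith

/-- The change factors as `(t - T) (e - b (t + T))`; the coefficient bounds give `26 = 10 + 2 * 8`.
-/
lemma abs_quadratic_sub_le {b c e σ T κ t : ℝ} (hT : 0 ≤ T) (hκ : 0 ≤ κ) (hκ1 : κ ≤ 1)
    (h : ∀ t ∈ Set.Icc 0 T, |c + e * t - b * t ^ 2| ≤ σ)
    (ht : t ∈ Set.Icc ((1 - κ) * T) T) :
    |(c + e * t - b * t ^ 2) - (c + e * T - b * T ^ 2)| ≤ 26 * κ * σ := by
  obtain ⟨hb, he⟩ := abs_coeff_le_of_abs_quadratic_le hT h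
  have h0 : 0 ≤ t := le_trans (mul_nonneg (by linarith) hT) ht.1
  have h1 : (c + e * t - b * t ^ 2) - (c + e * T - b * T ^ 2) = (t - T) * (e - b * (t + T)) := by
    ring
  have h2 : |t - T| ≤ κ * T := by
    rw [abs_le]
    constructor <;> nlinarith [ht.1, ht.2]
  have h3 : |e - b * (t + T)| ≤ |e| + |b| * (2 * T) := by
    calc _ ≤ |e| + |b * (t + T)| := abs_sub _ _
      _ ≤ _ := by
        rw [abs_mul, abs_of_nonneg (by linarith : 0 ≤ t + T)]
        gcongr
        linarith [ht.2]
  rw [h1, abs_mul]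
  have hκT : 0 ≤ κ * T := (abs_nonneg _).trans h2
  have hσ : 0 ≤ σ := (abs_nonneg _).trans (h 0 ⟨le_rfl, hT⟩)
  calc |t - T| * |e - b * (t + T)| ≤ κ * T * (|e| + |b| * (2 * T)) := by gcongr
    _ = κ * (|e| * T + 2 * (|b| * T ^ 2)) := by ring
    _ ≤ κ * (10 * σ + 2 * (8 * σ)) := by gcongr
    _ = _ := by ring

lemma mem_nhds_of_entries {A : Set G} {g₀ : G} (hA : A ∈ 𝓝 g₀) :
    ∃ δ > 0, ∀ g : G, (∀ i j, |g i j - g₀ i j| < δ) → g ∈ A := by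
  have h : 𝓝 g₀ = comap Subtype.val (𝓝 g₀.1) :=
    Matrix.SpecialLinearGroup.isClosedEmbedding_val.isInducing.nhds_eq_comap g₀
  rw [h] at hA
  obtain ⟨B, hB, hBA⟩ : ∃ B ∈ 𝓝 g₀.1, Subtype.val ⁻¹' B ⊆ A := hA
  obtain ⟨δ, hδ, hδB⟩ := Metric.mem_nhds_iff (α := Fin 2 → Fin 2 → ℝ).1 hB
  refine ⟨δ, hδ, fun g hg => hBA (hδB ?_)⟩
  have h1 : dist (α := Fin 2 → Fin 2 → ℝ) g.1 g₀.1 < δ :=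
    (dist_pi_lt_iff hδ).2 fun i => (dist_pi_lt_iff hδ).2 fun j => hg i j
  exact h1

lemma continuous_entry (i j : Fin 2) : Continuous fun g : G => g i j :=
  (continuous_apply_apply i j).comp Matrix.SpecialLinearGroup.isClosedEmbedding_val.continuous

/-- Only the lower-left entry is quadratic. When it becomes of order one at a late time, the
diagonal is still near `1`, so the displacement is nearly unipotent. -/
lemma conj_u_entries (g : G) (t : ℝ) :
    ((u t)⁻¹ * g * u t : G).1 = !![g 0 0 + g 0 1 * t, g 0 1;
      g 1 0 + (g 1 1 - g 0 0) * t - g 0 1 * t ^ 2, g 1 1 - g 0 1 * t] := by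
  have h : (u t)⁻¹ = u (-t) := by
    rw [inv_eq_iff_mul_eq_one, ← u_add, add_neg_cancel, u_zero]
  rw [h]
  change !![1, 0; -t, 1] * g.1 * !![1, 0; t, 1] = _
  rw [Matrix.eta_fin_two g.1]
  ext i j
  fin_cases i <;> fin_cases j <;> simp <;> ring

end PolynomialDivergence

/-! ### Generic points and the divergence of nearby orbits. -/

section Divergence

variable {Γ : Subgroup G}

/-- The averages of `f` along the orbits of the points of `E` converge to `m`, uniformly. -/
def UniformlyGeneric {Y : Type*} (φ : ℝ → Y → Y) (f : Y → ℝ) (m : ℝ) (E : Set Y) : Prop :=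
  ∀ ε > 0, ∃ T₀ : ℝ, ∀ T ≥ T₀, ∀ y ∈ E, |orbitIntegral φ f T y - T * m| ≤ ε * T

lemma abs_orbitIntegral_sub_floor_le {Y : Type*} [MeasurableSpace Y] {φ : ℝ → Y → Y}
    (hφ : IsMeasurableFlow φ) {f : Y → ℝ} {C : ℝ} (hf : Measurable f) (hC : ∀ y, |f y| ≤ C)
    {T : ℝ} (hT : 0 ≤ T) (y : Y) :
    |orbitIntegral φ f T y - orbitIntegral φ f ⌊T⌋₊ y| ≤ C := by
  have hi := hφ.intervalIntegrable hf hC y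
  rw [orbitIntegral, orbitIntegral, intervalIntegral.integral_interval_sub_left (hi _ _) (hi _ _)]
  refine (abs_intervalIntegral_orbit_le hC y _ _).trans ?_
  have h1 := Nat.floor_le hT
  have h2 := Nat.lt_floor_add_one T
  have hC0 : 0 ≤ C := (abs_nonneg _).trans (hC y)
  rw [abs_of_nonneg (by linarith)]
  nlinarith

lemma uniformlyGeneric_of_tendstoUniformlyOn {Y : Type*} [MeasurableSpace Y] {φ : ℝ → Y → Y}
    (hφ : IsMeasurableFlow φ) {f : Y → ℝ} {C m : ℝ} (hf : Measurable f) (hC : ∀ y, |f y| ≤ C)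
    {E : Set Y}
    (h : TendstoUniformlyOn (fun (N : ℕ) y => orbitIntegral φ f N y / N) (fun _ => m) atTop E) :
    UniformlyGeneric φ f m E := by
  intro ε hε
  obtain ⟨N₀, hN₀⟩ := eventually_atTop.1 (Metric.tendstoUniformlyOn_iff.1 h (ε / 2) (half_pos hε))
  -- The first two bounds make `⌊T⌋₊` at least `N₀` and positive; the third absorbs the rounding
  -- error `C + |m|` into `ε / 2 * T`.
  refine ⟨max (max (N₀ + 1) 1) ((C + |m|) / (ε / 2)), fun T hT y hy => ?_⟩
  simp only [ge_iff_le, max_le_iff] at hT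
  obtain ⟨⟨hT1, hT2⟩, hT3⟩ := hT
  have hT0 : 0 ≤ T := by linarith
  have h1 := Nat.floor_le hT0
  have h2 := Nat.lt_floor_add_one T
  set N := ⌊T⌋₊
  have hN : N₀ ≤ N := Nat.le_floor (by linarith)
  have hNpos : (0 : ℝ) < N := Nat.cast_pos.2 (Nat.floor_pos.2 hT2)
  have h3 := hN₀ N hN y hy
  rw [dist_comm, Real.dist_eq] at h3
  have h4 : |orbitIntegral φ f N y - N * m| ≤ ε / 2 * N := by
    have : orbitIntegral φ f N y - N * m = (orbitIntegral φ f N y / N - m) * N := by field_simp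
    rw [this, abs_mul, abs_of_pos hNpos]
    gcongr
  have h5 := abs_orbitIntegral_sub_floor_le hφ hf hC hT0 y
  have h6 : |(N - T) * m| ≤ |m| := by
    rw [abs_mul]
    refine mul_le_of_le_one_left (abs_nonneg _) ?_
    rw [abs_le]
    constructor <;> linarith
  rw [div_le_iff₀ (half_pos hε)] at hT3
  have h7 : orbitIntegral φ f T y - T * m = (orbitIntegral φ f T y - orbitIntegral φ f N y)
      + (orbitIntegral φ f N y - N * m) + (N - T) * m := by ring
  rw [h7]
  refine (abs_add_three _ _ _).trans ?_
  nlinarith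

/-- The final window is a difference of two long initial segments, each already well averaged. -/
lemma UniformlyGeneric.abs_window_sub_le {Y : Type*} [MeasurableSpace Y] {φ : ℝ → Y → Y}
    (hφ : IsMeasurableFlow φ) {f : Y → ℝ} {C m : ℝ} (hf : Measurable f) (hC : ∀ y, |f y| ≤ C)
    {E : Set Y} (h : UniformlyGeneric φ f m E) {κ ε : ℝ} (hκ : 0 < κ) (hκ1 : κ < 1) (hε : 0 < ε) :
    ∃ T₀, ∀ T ≥ T₀, ∀ y ∈ E, |(∫ t in ((1 - κ) * T)..T, f (φ t y)) - κ * T * m| ≤ ε * T := by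
  obtain ⟨T₀, hT₀⟩ := h (ε / 2) (half_pos hε)
  refine ⟨max (max T₀ 0) (T₀ / (1 - κ)), fun T hT y hy => ?_⟩
  simp only [ge_iff_le, max_le_iff] at hT
  obtain ⟨⟨hT1, hT2⟩, hT3⟩ := hT
  rw [div_le_iff₀ (by linarith)] at hT3
  have hi := hφ.intervalIntegrable hf hC y
  have h1 := hT₀ T hT1 y hy
  have h2 := hT₀ ((1 - κ) * T) (by linarith) y hy
  have h3 : (∫ t in ((1 - κ) * T)..T, f (φ t y)) - κ * T * m
      = (orbitIntegral φ f T y - T * m)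
        - (orbitIntegral φ f ((1 - κ) * T) y - (1 - κ) * T * m) := by
    rw [orbitIntegral, orbitIntegral,
      ← intervalIntegral.integral_interval_sub_left (hi _ _) (hi _ _)]
    ring
  rw [h3]
  refine (abs_sub _ _).trans ?_
  have : 0 ≤ κ * T := by positivity
  nlinarith

lemma abs_sub_le_of_window {Y : Type*} [MeasurableSpace Y] {φ : ℝ → Y → Y}
    (hφ : IsMeasurableFlow φ) {f f' : Y → ℝ} {C m m' ε ε' κ T : ℝ} (hf : Measurable f)
    (hf' : Measurable f') (hC : ∀ y, |f y| ≤ C) (hC' : ∀ y, |f' y| ≤ C) (hκ : 0 ≤ κ) (hT : 0 < T)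
    {y y' : Y}
    (h1 : |(∫ t in ((1 - κ) * T)..T, f (φ t y)) - κ * T * m| ≤ ε * T)
    (h2 : |(∫ t in ((1 - κ) * T)..T, f' (φ t y')) - κ * T * m'| ≤ ε * T)
    (h : ∀ t ∈ Set.Icc ((1 - κ) * T) T, |f (φ t y) - f' (φ t y')| ≤ ε') :
    κ * |m - m'| ≤ 2 * ε + κ * ε' := by
  have hle : (1 - κ) * T ≤ T := by nlinarith
  have h3 : |∫ t in ((1 - κ) * T)..T, (f (φ t y) - f' (φ t y'))| ≤ ε' * |T - (1 - κ) * T| := by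
    rw [← Real.norm_eq_abs (∫ t in ((1 - κ) * T)..T, (f (φ t y) - f' (φ t y')))]
    refine intervalIntegral.norm_integral_le_of_norm_le_const fun t ht => h t ?_
    rw [Set.uIoc_of_le hle] at ht
    exact Set.Ioc_subset_Icc_self ht
  rw [intervalIntegral.integral_sub (hφ.intervalIntegrable hf hC y _ _)
    (hφ.intervalIntegrable hf' hC' y' _ _), abs_of_nonneg (by linarith : 0 ≤ T - (1 - κ) * T)] at h3
  have h4 : |κ * T * (m - m')| ≤ 2 * ε * T + ε' * (κ * T) := by
    rw [abs_le] at h1 h2 h3 ⊢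
    constructor <;> linarith [h1.1, h1.2, h2.1, h2.2, h3.1, h3.2]
  rw [abs_mul, abs_of_nonneg (by positivity)] at h4
  have h5 : (κ * |m - m'|) * T ≤ (2 * ε + κ * ε') * T := by linarith
  exact le_of_mul_le_mul_right h5 hT

/-- Two points in a fibre, close to each other and uniformly generic for a test function that
detects the vertical translation by `s`, differ by an element of the unipotent subgroup. -/
lemma eventually_eq_u {f : X Γ × X Γ → ℝ} (hf : Continuous f) (hfs : HasCompactSupport f)
    {s m m' : ℝ} (hm : m ≠ m') {E : Set (X Γ × X Γ)}
    (hE : UniformlyGeneric (diagonalFlow Γ) f m E)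
    (hE' : UniformlyGeneric (diagonalFlow Γ) (f ∘ verticalFlow Γ s) m' E) (hs : s ≠ 0) :
    ∀ᶠ g in 𝓝 (1 : G), ∀ p ∈ E, translateSnd Γ g p ∈ E → ∃ c, g = u c := by
  obtain ⟨C, hC⟩ := hfs.exists_bound_of_continuous hf
  simp only [Real.norm_eq_abs] at hC
  have hC' : ∀ p, |(f ∘ verticalFlow Γ s) p| ≤ C := fun p => hC _
  have hfm : Measurable f := hf.measurable
  have hfm' : Measurable (f ∘ verticalFlow Γ s) :=
    (hf.comp (continuous_translateSnd (u s))).measurable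
  have hφ := isMeasurableFlow_diagonalFlow (Γ := Γ)
  have hσ : 0 < |s| := abs_pos.2 hs
  set Δ := |m - m'| with hΔ
  have hΔ0 : 0 < Δ := abs_pos.2 (sub_ne_zero.2 hm)
  have hV := eventually_abs_translateSnd_sub_lt hf hfs (half_pos hΔ0)
  -- A displacement near `u s` makes `f` at the moved point close to `f ∘ ξ_s` at the original one;
  -- near `u (-s)` the two functions exchange roles.
  have hplus : {h : G | ∀ p, |f (translateSnd Γ ((u s)⁻¹ * h) p) - f p| < Δ / 2} ∈ 𝓝 (u s) := by
    have : Tendsto (fun h : G => (u s)⁻¹ * h) (𝓝 (u s)) (𝓝 1) := by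
      simpa using (continuous_const_mul (u s)⁻¹).tendsto (u s)
    exact this.eventually hV
  have hminus : {h : G | ∀ p, |f (translateSnd Γ (h * u s) p) - f p| < Δ / 2} ∈ 𝓝 (u (-s)) := by
    have : Tendsto (fun h : G => h * u s) (𝓝 (u (-s))) (𝓝 1) := by
      have h := (continuous_mul_const (u s)).tendsto (u (-s))
      rwa [← u_add, neg_add_cancel, u_zero] at h
    exact this.eventually hV
  obtain ⟨δ₁, hδ₁, hplus⟩ := mem_nhds_of_entries hplus
  obtain ⟨δ₂, hδ₂, hminus⟩ := mem_nhds_of_entries hminus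
  set δ := min δ₁ δ₂
  have hδ : 0 < δ := lt_min hδ₁ hδ₂
  -- With `26 κ |s| < δ`, the quadratic entry moves by less than `δ` over the window.
  obtain ⟨κ, hκ, hκδ⟩ : ∃ κ, 0 < κ ∧ κ < min 1 (δ / (26 * |s|)) :=
    exists_between (lt_min one_pos (by positivity))
  obtain ⟨hκ1, hκ2⟩ := lt_min_iff.1 hκδ
  rw [lt_div_iff₀ (by positivity)] at hκ2
  -- With error `κ Δ / 8`, the comparison of means would read `κ Δ ≤ 2 (κ Δ / 8) + κ Δ / 2`, which
  -- is false.
  obtain ⟨T₁, hT₁⟩ := hE.abs_window_sub_le hφ hfm hC hκ hκ1 (ε := κ * Δ / 8) (by positivity)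
  obtain ⟨T₂, hT₂⟩ := hE'.abs_window_sub_le hφ hfm' hC' hκ hκ1 (ε := κ * Δ / 8) (by positivity)
  -- The last term and `|g 0 1| T ^ 2 ≤ 8 |s|` give `|g 0 1| T < δ / 2`, which controls the diagonal
  -- entries.
  set T₀ := max (max T₁ T₂) (16 * |s| / δ)
  have htend : ∀ i j, Tendsto (fun g : G => g i j) (𝓝 1) (𝓝 ((1 : G) i j)) := fun i j =>
    (continuous_entry i j).tendsto 1
  have ht00 : Tendsto (fun g : G => g 0 0) (𝓝 1) (𝓝 1) := by simpa using htend 0 0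
  have ht01 : Tendsto (fun g : G => g 0 1) (𝓝 1) (𝓝 0) := by simpa using htend 0 1
  have ht10 : Tendsto (fun g : G => g 1 0) (𝓝 1) (𝓝 0) := by simpa using htend 1 0
  have ht11 : Tendsto (fun g : G => g 1 1) (𝓝 1) (𝓝 1) := by simpa using htend 1 1
  have e1 : ∀ᶠ g : G in 𝓝 1, |g 1 0| < |s| / 3 :=
    (by simpa using ht10.abs : Tendsto (fun g : G => |g 1 0|) (𝓝 1) (𝓝 0)).eventually_lt_const
      (by positivity)
  have e2 : ∀ᶠ g : G in 𝓝 1, |g 1 1 - g 0 0| * T₀ < |s| / 3 :=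
    (by simpa using ((ht11.sub ht00).abs.mul_const T₀) :
      Tendsto (fun g : G => |g 1 1 - g 0 0| * T₀) (𝓝 1) (𝓝 0)).eventually_lt_const (by positivity)
  have e3 : ∀ᶠ g : G in 𝓝 1, |g 0 1| * T₀ ^ 2 < |s| / 3 :=
    (by simpa using (ht01.abs.mul_const (T₀ ^ 2)) :
      Tendsto (fun g : G => |g 0 1| * T₀ ^ 2) (𝓝 1) (𝓝 0)).eventually_lt_const (by positivity)
  have e4 : ∀ᶠ g : G in 𝓝 1, |g 0 0 - 1| < δ / 2 :=
    (by simpa using (ht00.sub_const 1).abs :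
      Tendsto (fun g : G => |g 0 0 - 1|) (𝓝 1) (𝓝 0)).eventually_lt_const (by positivity)
  have e5 : ∀ᶠ g : G in 𝓝 1, |g 1 1 - 1| < δ / 2 :=
    (by simpa using (ht11.sub_const 1).abs :
      Tendsto (fun g : G => |g 1 1 - 1|) (𝓝 1) (𝓝 0)).eventually_lt_const (by positivity)
  have e6 : ∀ᶠ g : G in 𝓝 1, |g 0 1| < δ :=
    (by simpa using ht01.abs : Tendsto (fun g : G => |g 0 1|) (𝓝 1) (𝓝 0)).eventually_lt_const hδ
  have e7 : ∀ᶠ g : G in 𝓝 1, 0 < g 0 0 := ht00.eventually_const_lt one_pos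
  filter_upwards [e1, e2, e3, e4, e5, e6, e7] with g h1 h2 h3 h4 h5 h6 h7 p hp hp'
  by_cases hbe : g 0 1 ≠ 0 ∨ g 1 1 - g 0 0 ≠ 0
  · exfalso
    obtain ⟨T, hT0, hTs, hTle⟩ :=
      exists_first_abs_quadratic_eq (h1.trans (by linarith : |s| / 3 < |s|)) hbe
    have hT : T₀ < T := lt_of_abs_quadratic_eq hT0.le h1 h2 h3 hTs
    have hTa : T₁ ≤ T := (le_max_left _ _).trans ((le_max_left _ _).trans hT.le)
    have hTb : T₂ ≤ T := (le_max_right _ _).trans ((le_max_left _ _).trans hT.le)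
    have hTc : 16 * |s| < δ * T := by
      have := (le_max_right (max T₁ T₂) (16 * |s| / δ)).trans_lt hT
      rw [div_lt_iff₀ hδ] at this
      linarith
    have hbT := (abs_coeff_le_of_abs_quadratic_le hT0.le hTle).1
    have hbT' : |g 0 1| * T < δ / 2 := by
      by_contra! hcon
      have : δ / 2 * T ≤ |g 0 1| * T * T := by gcongr
      nlinarith
    have hentries : ∀ s', g 1 0 + (g 1 1 - g 0 0) * T - g 0 1 * T ^ 2 = s' →
        ∀ t ∈ Set.Icc ((1 - κ) * T) T, ∀ i j,
          |((u t)⁻¹ * g * u t : G) i j - u s' i j| < δ := by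
      intro s' hs' t ht i j
      have ht0 : 0 ≤ t := le_trans (mul_nonneg (by linarith) hT0.le) ht.1
      have hbt : |g 0 1 * t| < δ / 2 := by
        rw [abs_mul, abs_of_nonneg ht0]
        exact lt_of_le_of_lt (by gcongr; exact ht.2) hbT'
      have hq := abs_quadratic_sub_le hT0.le hκ.le hκ1.le hTle ht
      rw [hs'] at hq
      rw [conj_u_entries]
      rw [abs_lt] at hbt h4 h5
      fin_cases i <;> fin_cases j <;> simp [u]
      · rw [abs_lt]
        constructor <;> linarith [hbt.1, hbt.2, h4.1, h4.2]
      · exact h6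
      · exact lt_of_le_of_lt hq (by linarith)
      · rw [abs_lt]
        constructor <;> linarith [hbt.1, hbt.2, h5.1, h5.2]
    rcases (abs_eq_abs.1 hTs) with hq | hq
    · have hclose : ∀ t ∈ Set.Icc ((1 - κ) * T) T,
          |f (diagonalFlow Γ t (translateSnd Γ g p))
            - (f ∘ verticalFlow Γ s) (diagonalFlow Γ t p)| ≤ Δ / 2 := by
        intro t ht
        have := hplus _ (fun i j => (hentries s hq t ht i j).trans_le (min_le_left _ _))
          (verticalFlow Γ s (diagonalFlow Γ t p))
        rw [verticalFlow_eq, ← translateSnd_mul, mul_inv_cancel_left] at this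
        rw [diagonalFlow_translateSnd]
        exact this.le
      have := abs_sub_le_of_window hφ hfm hfm' hC hC' hκ.le hT0 (hT₁ T hTa _ hp') (hT₂ T hTb _ hp)
        hclose
      rw [← hΔ] at this
      nlinarith [mul_pos hκ hΔ0]
    · have hclose : ∀ t ∈ Set.Icc ((1 - κ) * T) T,
          |(f ∘ verticalFlow Γ s) (diagonalFlow Γ t (translateSnd Γ g p))
            - f (diagonalFlow Γ t p)| ≤ Δ / 2 := by
        intro t ht
        have := hminus _ (fun i j => (hentries (-s) hq t ht i j).trans_le (min_le_right _ _))
          (diagonalFlow Γ t p)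
        rw [translateSnd_mul] at this
        rw [diagonalFlow_translateSnd]
        exact this.le
      have := abs_sub_le_of_window hφ hfm' hfm hC' hC hκ.le hT0 (hT₂ T hTb _ hp') (hT₁ T hTa _ hp)
        hclose
      rw [abs_sub_comm, ← hΔ] at this
      nlinarith [mul_pos hκ hΔ0]
  -- With constant displacement, `g` is lower triangular with equal diagonal entries; the
  -- determinant and `0 < g 0 0` make them `1`.
  · push Not at hbe
    have hdet := g.2
    rw [Matrix.det_fin_two] at hdet
    have hdet' : g 0 0 * g 1 1 - g 0 1 * g 1 0 = 1 := hdet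
    rw [hbe.1, sub_eq_zero.1 hbe.2] at hdet'
    have h00 : g 0 0 = 1 := by nlinarith
    refine ⟨g 1 0, Matrix.SpecialLinearGroup.ext _ _ fun i j => ?_⟩
    fin_cases i <;> fin_cases j <;> simp [u]
    · exact h00
    · exact hbe.1
    · linarith [hbe.2]

end Divergence

/-! ### Periods, separated sets and finite fibres. -/

section FiniteFibers

variable {Γ : Subgroup G}

lemma eventually_abs_verticalFlow_sub_lt {f : X Γ × X Γ → ℝ} (hf : Continuous f)
    (hfs : HasCompactSupport f) (r : ℝ) {ε : ℝ} (hε : 0 < ε) :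
    ∀ᶠ r' in 𝓝 r, ∀ p, |f (verticalFlow Γ r' p) - f (verticalFlow Γ r p)| < ε := by
  have h : Tendsto (fun r' => u (-r + r')) (𝓝 r) (𝓝 1) := by
    have : Continuous fun r' => u (-r + r') := continuous_u.comp (by fun_prop)
    simpa [u_zero] using this.tendsto r
  filter_upwards [h.eventually (eventually_abs_translateSnd_sub_lt hf hfs hε)] with r' hr' p
  have := hr' (verticalFlow Γ r p)
  rwa [verticalFlow_eq, ← translateSnd_mul, ← u_add, add_neg_cancel_left] at this

lemma integrable_comp_verticalFlow {μ : Measure (X Γ × X Γ)} [IsFiniteMeasure μ]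
    {f : X Γ × X Γ → ℝ} (hf : Continuous f) (hfs : HasCompactSupport f) (r : ℝ) :
    Integrable (f ∘ verticalFlow Γ r) μ := by
  obtain ⟨C, hC⟩ := hfs.exists_bound_of_continuous hf
  exact Integrable.of_bound
    (hf.comp (continuous_translateSnd (u r))).measurable.aestronglyMeasurable C
    (ae_of_all _ fun p => hC _)

lemma abs_integral_sub_le_of_forall {Y : Type*} [MeasurableSpace Y] {μ : Measure Y}
    [IsProbabilityMeasure μ] {f g : Y → ℝ} (hf : Integrable f μ) (hg : Integrable g μ) {ε : ℝ}
    (h : ∀ y, |f y - g y| ≤ ε) : |∫ y, f y ∂μ - ∫ y, g y ∂μ| ≤ ε := by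
  rw [← integral_sub hf hg]
  simpa using norm_integral_le_of_norm_le_const (μ := μ) (f := fun y => f y - g y) (ae_of_all _ h)

lemma continuous_integral_comp_verticalFlow (μ : Measure (X Γ × X Γ)) [IsProbabilityMeasure μ]
    {f : X Γ × X Γ → ℝ} (hf : Continuous f) (hfs : HasCompactSupport f) :
    Continuous fun r => ∫ p, (f ∘ verticalFlow Γ r) p ∂μ := by
  refine continuous_iff_continuousAt.2 fun r => Metric.tendsto_nhds.2 fun ε hε => ?_
  filter_upwards [eventually_abs_verticalFlow_sub_lt hf hfs r (half_pos hε)] with r' hr'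
  refine lt_of_le_of_lt ?_ (half_lt_self hε)
  exact abs_integral_sub_le_of_forall (integrable_comp_verticalFlow hf hfs r')
    (integrable_comp_verticalFlow hf hfs r) fun p => (hr' p).le

/-- The averages along the orbit of `p` of each vertical translate of `f` by a rational time
converge to its integral. -/
def VerticallyGeneric (μ : Measure (X Γ × X Γ)) (f : X Γ × X Γ → ℝ) (p : X Γ × X Γ) : Prop :=
  ∀ r : ℚ, Tendsto (fun N : ℕ => orbitIntegral (diagonalFlow Γ) (f ∘ verticalFlow Γ r) N p / N)
    atTop (𝓝 (∫ p, (f ∘ verticalFlow Γ r) p ∂μ))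

/-- Rational times keep the exceptional null set a countable union; uniform continuity in `r`
extends convergence to all real times, without enlarging that set. -/
lemma VerticallyGeneric.tendsto {μ : Measure (X Γ × X Γ)} [IsProbabilityMeasure μ]
    {f : X Γ × X Γ → ℝ} (hf : Continuous f) (hfs : HasCompactSupport f) {p : X Γ × X Γ}
    (hp : VerticallyGeneric μ f p) (r : ℝ) :
    Tendsto (fun N : ℕ => orbitIntegral (diagonalFlow Γ) (f ∘ verticalFlow Γ r) N p / N)
      atTop (𝓝 (∫ p, (f ∘ verticalFlow Γ r) p ∂μ)) := by
  rw [Metric.tendsto_nhds]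
  intro ε hε
  obtain ⟨q, hq⟩ := Rat.denseRange_cast.exists_mem_open isOpen_interior
    ⟨r, mem_interior_iff_mem_nhds.2
      (eventually_abs_verticalFlow_sub_lt hf hfs r (div_pos hε three_pos))⟩
  have hq' : ∀ p, |f (verticalFlow Γ q p) - f (verticalFlow Γ r p)| < ε / 3 := interior_subset hq
  have h1 := abs_integral_sub_le_of_forall (μ := μ) (integrable_comp_verticalFlow hf hfs q)
    (integrable_comp_verticalFlow hf hfs r) fun p => (hq' p).le
  obtain ⟨C, hC⟩ := hfs.exists_bound_of_continuous hf
  have hi : ∀ (r : ℝ) (N : ℕ), IntervalIntegrable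
      (fun t => (f ∘ verticalFlow Γ r) (diagonalFlow Γ t p)) volume 0 N := fun r N =>
    isMeasurableFlow_diagonalFlow.intervalIntegrable
      (hf.comp (continuous_translateSnd (u r))).measurable (fun p => hC _) p 0 N
  filter_upwards [Metric.tendsto_nhds.1 (hp q) (ε / 3) (div_pos hε three_pos),
    eventually_gt_atTop 0] with N hN hN0
  have hN0' : (0 : ℝ) < N := Nat.cast_pos.2 hN0
  have h2 : |orbitIntegral (diagonalFlow Γ) (f ∘ verticalFlow Γ q) N p / N
      - orbitIntegral (diagonalFlow Γ) (f ∘ verticalFlow Γ r) N p / N| ≤ ε / 3 := by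
    rw [← sub_div, abs_div, abs_of_pos hN0', div_le_iff₀ hN0', orbitIntegral, orbitIntegral,
      ← intervalIntegral.integral_sub (hi q N) (hi r N), ← Real.norm_eq_abs]
    have := intervalIntegral.norm_integral_le_of_norm_le_const (a := 0) (b := N) (C := ε / 3)
      (f := fun t => (f ∘ verticalFlow Γ q) (diagonalFlow Γ t p)
        - (f ∘ verticalFlow Γ r) (diagonalFlow Γ t p)) fun t _ => (hq' _).le
    rwa [sub_zero, abs_of_pos hN0'] at this
  rw [Real.dist_eq] at hN ⊢
  rw [abs_lt] at hN ⊢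
  rw [abs_le] at h1 h2
  constructor <;> linarith [h1.1, h1.2, h2.1, h2.2, hN.1, hN.2]

/-- The vertical and diagonal flows commute, so the averages of `f ∘ ξ_r` from `ξ_c p` are those of
`f ∘ ξ_{r + c}` from `p`. -/
lemma VerticallyGeneric.periodic {μ : Measure (X Γ × X Γ)} [IsProbabilityMeasure μ]
    {f : X Γ × X Γ → ℝ} (hf : Continuous f) (hfs : HasCompactSupport f) {p : X Γ × X Γ} {c : ℝ}
    (hp : VerticallyGeneric μ f p) (hp' : VerticallyGeneric μ f (verticalFlow Γ c p)) :
    Function.Periodic (fun r => ∫ p, (f ∘ verticalFlow Γ r) p ∂μ) c := by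
  intro r
  refine tendsto_nhds_unique (hp.tendsto hf hfs (r + c)) ?_
  refine (hp'.tendsto hf hfs r).congr fun N => ?_
  congr 1
  refine intervalIntegral.integral_congr fun t _ => ?_
  have h : verticalFlow Γ r (diagonalFlow Γ t (verticalFlow Γ c p))
      = verticalFlow Γ (r + c) (diagonalFlow Γ t p) := by
    have h2 : diagonalFlow Γ t (verticalFlow Γ c p) = verticalFlow Γ c (diagonalFlow Γ t p) := by
      rw [verticalFlow_eq, diagonalFlow_translateSnd, mul_assoc, ← u_add, add_comm, u_add,
        inv_mul_cancel_left]
    rw [h2, isMeasurableFlow_verticalFlow.map_add]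
  simp only [Function.comp_apply, h]

/-- Steps of size `|c| < δ` from `a` land within `δ` of `b`, where `h` avoids the value `h a`. -/
lemma exists_pos_forall_not_periodic {h : ℝ → ℝ} (hh : Continuous h) {a b : ℝ}
    (hab : h a ≠ h b) : ∃ δ > 0, ∀ c, |c| < δ → Function.Periodic h c → c = 0 := by
  obtain ⟨δ, hδ, hδb⟩ := Metric.eventually_nhds_iff.1
    (hh.continuousAt.eventually_ne hab.symm : ∀ᶠ t in 𝓝 b, h t ≠ h a)
  refine ⟨δ, hδ, fun c hc hper => by_contra fun hc0 => ?_⟩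
  set n := ⌊(b - a) / c⌋
  refine hδb (y := a + n * c) ?_ (hper.int_mul n a)
  have h1 : a + n * c - b = -(Int.fract ((b - a) / c) * c) := by
    rw [Int.fract, sub_mul, div_mul_cancel₀ _ hc0]
    ring
  rw [Real.dist_eq, h1, abs_neg, abs_mul, abs_of_nonneg (Int.fract_nonneg _)]
  exact lt_of_le_of_lt (mul_le_of_le_one_left (abs_nonneg _) (Int.fract_lt_one _).le) hc

/-- A joining that is not invariant under the vertical flow gives positive measure to a set in
which points of the same fibre are uniformly separated. -/
lemma exists_measure_pos_translateSnd_discrete {μ : Measure (X Γ × X Γ)} [IsProbabilityMeasure μ]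
    [T2Space (X Γ)] (herg : IsErgodicFlow (diagonalFlow Γ) μ) {f : X Γ × X Γ → ℝ}
    (hf : Continuous f) (hfs : HasCompactSupport f) {s : ℝ}
    (hs : ∫ p, f p ∂μ ≠ ∫ p, (f ∘ verticalFlow Γ s) p ∂μ) :
    ∃ (E : Set (X Γ × X Γ)) (K : Set (X Γ)), MeasurableSet E ∧ 0 < μ E ∧ IsCompact K ∧
      (∀ p ∈ E, p.2 ∈ K) ∧
      ∀ᶠ g in 𝓝 (1 : G), ∀ p ∈ E, translateSnd Γ g p ∈ E → g = 1 := by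
  have hφ := isMeasurableFlow_diagonalFlow (Γ := Γ)
  obtain ⟨C, hC⟩ := hfs.exists_bound_of_continuous hf
  simp only [Real.norm_eq_abs] at hC
  have hm : ∀ r, Measurable (f ∘ verticalFlow Γ r) := fun r =>
    (hf.comp (continuous_translateSnd (u r))).measurable
  have hv0 : f ∘ verticalFlow Γ 0 = f :=
    funext fun p => congrArg f (isMeasurableFlow_verticalFlow.map_zero p)
  have hbirk : ∀ r : ℝ, ∀ᵐ p ∂μ,
      Tendsto (fun N : ℕ => orbitIntegral (diagonalFlow Γ) (f ∘ verticalFlow Γ r) N p / N)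
        atTop (𝓝 (∫ p, (f ∘ verticalFlow Γ r) p ∂μ)) := fun r =>
    ae_tendsto_orbitIntegral_div hφ herg (hm r) fun p => hC _
  have hegorov : ∀ r : ℝ, ∃ t, MeasurableSet t ∧ μ t ≤ ENNReal.ofReal (1 / 4) ∧
      UniformlyGeneric (diagonalFlow Γ) (f ∘ verticalFlow Γ r)
        (∫ p, (f ∘ verticalFlow Γ r) p ∂μ) tᶜ := fun r => by
    obtain ⟨t, ht, htμ, htu⟩ := tendstoUniformlyOn_of_ae_tendsto'
      (fun N : ℕ => ((measurable_orbitIntegral hφ (hm r) N).div_const N).stronglyMeasurable)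
      (stronglyMeasurable_const) (hbirk r) (ε := 1 / 4) (by norm_num)
    exact ⟨t, ht, htμ, uniformlyGeneric_of_tendstoUniformlyOn hφ (hm r) (fun p => hC _) htu⟩
  obtain ⟨t₁, ht₁, hμ₁, hu₁⟩ := hegorov 0
  obtain ⟨t₂, ht₂, hμ₂, hu₂⟩ := hegorov s
  rw [hv0] at hu₁
  have hgen : ∀ᵐ p ∂μ, VerticallyGeneric μ f p := ae_all_iff.2 fun r : ℚ => hbirk r
  obtain ⟨D, hD, hDm, hDμ⟩ := exists_measurable_superset_of_null (ae_iff.1 hgen)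
  have := TopologicalSpace.metrizableSpace_of_t3_secondCountable (X Γ)
  -- Mass above `3 / 4` outweighs the two Egorov exceptional sets of mass at most `1 / 4` each, so
  -- `E` below has positive measure.
  obtain ⟨K, -, hK, hKμ⟩ := (isOpen_univ (X := X Γ)).exists_lt_isCompact
    (μ := μ.map Prod.snd) (r := ENNReal.ofReal (3 / 4)) (by
      rw [Measure.map_apply measurable_snd .univ, Set.preimage_univ, measure_univ]
      exact ENNReal.ofReal_lt_one.2 (by norm_num))
  rw [Measure.map_apply measurable_snd hK.measurableSet] at hKμ
  have hKm : MeasurableSet (Prod.snd ⁻¹' K : Set (X Γ × X Γ)) := measurable_snd hK.measurableSet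
  set E : Set (X Γ × X Γ) := Prod.snd ⁻¹' K \ (t₁ ∪ t₂ ∪ D)
  have hE₁ : E ⊆ t₁ᶜ := fun p hp h => hp.2 (Or.inl (Or.inl h))
  have hE₂ : E ⊆ t₂ᶜ := fun p hp h => hp.2 (Or.inl (Or.inr h))
  have hE₃ : ∀ p ∈ E, VerticallyGeneric μ f p := fun p hp =>
    by_contra fun h => hp.2 (Or.inr (hD h))
  refine ⟨E, K, hKm.diff ((ht₁.union ht₂).union hDm), ?_, hK, fun p hp => hp.1, ?_⟩
  · refine lt_of_lt_of_le (tsub_pos_of_lt ?_) le_measure_sdiff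
    refine lt_of_le_of_lt ?_ hKμ
    calc μ (t₁ ∪ t₂ ∪ D) ≤ μ (t₁ ∪ t₂) + μ D := measure_union_le _ _
      _ ≤ ENNReal.ofReal (1 / 4) + ENNReal.ofReal (1 / 4) + 0 := by
        rw [hDμ]
        gcongr
        exact (measure_union_le _ _).trans (add_le_add hμ₁ hμ₂)
      _ ≤ ENNReal.ofReal (3 / 4) := by
        rw [add_zero, ← ENNReal.ofReal_add (by norm_num) (by norm_num)]
        exact ENNReal.ofReal_le_ofReal (by norm_num)
  · have hs0 : s ≠ 0 := by
      rintro rfl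
      exact hs (by rw [hv0])
    have hrestrict : ∀ {f : X Γ × X Γ → ℝ} {m : ℝ} {A : Set (X Γ × X Γ)}, E ⊆ A →
        UniformlyGeneric (diagonalFlow Γ) f m A → UniformlyGeneric (diagonalFlow Γ) f m E :=
      fun hA h ε hε => (h ε hε).imp fun T₀ hT₀ T hT y hy => hT₀ T hT y (hA hy)
    obtain ⟨δ, hδ, hper⟩ := exists_pos_forall_not_periodic (a := 0) (b := s)
      (continuous_integral_comp_verticalFlow μ hf hfs) (by rw [hv0]; exact hs)
    have hsmall : ∀ᶠ g : G in 𝓝 1, |g 1 0| < δ := by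
      have h := ((continuous_entry 1 0).tendsto 1).abs
      simp only [Matrix.SpecialLinearGroup.coe_one, ne_eq, one_ne_zero, not_false_eq_true,
        Matrix.one_apply_ne, abs_zero] at h
      exact h.eventually_lt_const hδ
    filter_upwards [hsmall, eventually_eq_u hf hfs hs (hrestrict hE₁ hu₁) (hrestrict hE₂ hu₂) hs0]
      with g hg hgu p hp hp'
    obtain ⟨c, rfl⟩ := hgu p hp hp'
    have hc : |c| < δ := by simpa [u] using hg
    rw [hper c hc ((hE₃ p hp).periodic hf hfs (hE₃ _ hp')), u_zero]

/-- If the fibres of a set of positive measure have bounded cardinality, then almost every fibre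
is finite. -/
lemma exists_finite_fibers_of_card_le {μ : Measure (X Γ × X Γ)} [IsProbabilityMeasure μ]
    (herg : IsErgodicFlow (diagonalFlow Γ) μ) {E : Set (X Γ × X Γ)} (hE : MeasurableSet E)
    (hμE : 0 < μ E) {n : ℕ}
    (hn : ∀ (x : X Γ) (s : Finset (X Γ)), (∀ y ∈ s, (x, y) ∈ E) → s.card ≤ n) :
    ∃ Ω : Set (X Γ × X Γ), MeasurableSet Ω ∧ μ Ωᶜ = 0 ∧ ∀ x : X Γ, {y | (x, y) ∈ Ω}.Finite := by
  classical
  have hφ := isMeasurableFlow_diagonalFlow (Γ := Γ)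
  have hEm : Measurable (E.indicator (1 : X Γ × X Γ → ℝ)) := measurable_one.indicator hE
  have h := ae_tendsto_orbitIntegral_div hφ herg hEm (abs_indicator_one_le E)
  rw [integral_indicator_one hE] at h
  obtain ⟨D, hD, hDm, hDμ⟩ := exists_measurable_superset_of_null (ae_iff.1 h)
  refine ⟨Dᶜ, hDm.compl, by rwa [compl_compl], fun x => ?_⟩
  by_contra hinf
  have hE0 : 0 < μ.real E := ENNReal.toReal_pos hμE.ne' (measure_ne_top _ _)
  obtain ⟨k, hk⟩ := exists_nat_gt ((n : ℝ) / μ.real E)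
  obtain ⟨s, hs, hsk⟩ := (show Set.Infinite {y | (x, y) ∈ Dᶜ} from hinf).exists_subset_card_eq k
  -- Each of the `k` generic points visits `E` with frequency `μ E`, but at any time they lie in one
  -- fibre and at most `n` are in `E`. So `k μ(E) ≤ n`, against the choice of `k`.
  have hlim : Tendsto (fun N : ℕ => ∑ y ∈ s,
      orbitIntegral (diagonalFlow Γ) (E.indicator 1) N (x, y) / N) atTop
      (𝓝 (∑ _y ∈ s, μ.real E)) :=
    tendsto_finsetSum _ fun y hy => by_contra fun hcon => hs hy (hD hcon)
  have hle : ∑ _y ∈ s, μ.real E ≤ n := by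
    refine le_of_tendsto hlim ?_
    filter_upwards [eventually_gt_atTop 0] with N hN
    have hN' : (0 : ℝ) < N := Nat.cast_pos.2 hN
    rw [← Finset.sum_div, div_le_iff₀ hN']
    simp only [orbitIntegral]
    have hi : ∀ y, IntervalIntegrable
        (fun t => E.indicator (1 : X Γ × X Γ → ℝ) (diagonalFlow Γ t (x, y))) volume 0 N := fun y =>
      hφ.intervalIntegrable hEm (abs_indicator_one_le E) _ _ _
    rw [← intervalIntegral.integral_finsetSum fun y _ => hi y]
    have hcount : ∀ t, ∑ y ∈ s, E.indicator (1 : X Γ × X Γ → ℝ) (diagonalFlow Γ t (x, y)) ≤ n := by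
      intro t
      have hinj : Function.Injective (horocycleFlow Γ t) := fun y y' hyy => by
        have h0 := isMeasurableFlow_horocycleFlow (Γ := Γ)
        rw [← h0.map_zero y, ← h0.map_zero y', ← neg_add_cancel t, h0.map_add, h0.map_add, hyy]
      have h1 := hn (horocycleFlow Γ t x)
        ((s.filter fun y => diagonalFlow Γ t (x, y) ∈ E).image (horocycleFlow Γ t)) (by
          intro y hy
          obtain ⟨z, hz, rfl⟩ := Finset.mem_image.1 hy
          exact (Finset.mem_filter.1 hz).2)
      rw [Finset.card_image_of_injective _ hinj] at h1
      simp only [Set.indicator_apply, Pi.one_apply, Finset.sum_boole]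
      exact_mod_cast h1
    have hsum := IntervalIntegrable.sum s fun y _ => hi y
    rw [Finset.sum_fn] at hsum
    calc _ ≤ ∫ t in (0 : ℝ)..N, (n : ℝ) :=
          intervalIntegral.integral_mono_on hN'.le hsum intervalIntegrable_const
            fun t _ => hcount t
      _ = n * N := by simp [mul_comm]
  rw [Finset.sum_const, hsk, nsmul_eq_mul] at hle
  rw [div_lt_iff₀ hE0] at hk
  linarith

lemma IsSelfJoining.exists_finite_fibers {hΓ : IsLattice Γ} {μ : Measure (X Γ × X Γ)}
    (hμ : IsSelfJoining hΓ μ) (herg : IsErgodicFlow (diagonalFlow Γ) μ)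
    (hinv : ¬ ∀ t, MeasurePreserving (verticalFlow Γ t) μ μ) :
    ∃ Ω : Set (X Γ × X Γ), MeasurableSet Ω ∧ μ Ωᶜ = 0 ∧ ∀ x : X Γ, {y | (x, y) ∈ Ω}.Finite := by
  have := hμ.isProbabilityMeasure
  have := t2Space_of_isLattice hΓ
  have := TopologicalSpace.metrizableSpace_of_t3_secondCountable (X Γ)
  obtain ⟨s, hs⟩ := not_forall.1 hinv
  have hsm := (isMeasurableFlow_verticalFlow (Γ := Γ)).measurable_apply s
  obtain ⟨f, hf⟩ : ∃ f : CompactlySupportedContinuousMap (X Γ × X Γ) ℝ,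
      ∫ p, f p ∂μ ≠ ∫ p, f p ∂(μ.map (verticalFlow Γ s)) := by
    by_contra! hcon
    have := Measure.isProbabilityMeasure_map (μ := μ) hsm.aemeasurable
    exact hs ⟨hsm, (Measure.ext_of_integral_eq_on_compactlySupported hcon).symm⟩
  rw [integral_map (f := fun p => f p) hsm.aemeasurable
    f.continuous.measurable.aestronglyMeasurable] at hf
  obtain ⟨E, K, hE, hμE, hK, hEK, hsep⟩ := exists_measure_pos_translateSnd_discrete herg
    f.continuous f.hasCompactSupport hf
  obtain ⟨n, hn⟩ := exists_card_le_of_translateSnd_discrete hK hEK hsep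
  exact exists_finite_fibers_of_card_le herg hE hμE hn

lemma measurePreserving_swap_diagonalFlow {μ : Measure (X Γ × X Γ)} {t : ℝ}
    (h : MeasurePreserving (diagonalFlow Γ t) μ μ) :
    MeasurePreserving (diagonalFlow Γ t) (μ.map Prod.swap) (μ.map Prod.swap) := by
  refine ⟨h.measurable, ?_⟩
  conv_rhs => rw [← h.map_eq, Measure.map_map measurable_swap h.measurable]
  rw [Measure.map_map h.measurable measurable_swap]
  rfl

lemma IsSelfJoining.swap {hΓ : IsLattice Γ} {μ : Measure (X Γ × X Γ)} (hμ : IsSelfJoining hΓ μ) :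
    IsSelfJoining hΓ (μ.map Prod.swap) where
  isProbabilityMeasure :=
    have := hμ.isProbabilityMeasure
    Measure.isProbabilityMeasure_map measurable_swap.aemeasurable
  invariant t := measurePreserving_swap_diagonalFlow (hμ.invariant t)
  map_fst := by
    rw [Measure.map_map measurable_fst measurable_swap]
    exact hμ.map_snd
  map_snd := by
    rw [Measure.map_map measurable_snd measurable_swap]
    exact hμ.map_fst

lemma IsErgodicFlow.swap {μ : Measure (X Γ × X Γ)} (herg : IsErgodicFlow (diagonalFlow Γ) μ) :
    IsErgodicFlow (diagonalFlow Γ) (μ.map Prod.swap) where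
  invariant t := measurePreserving_swap_diagonalFlow (herg.invariant t)
  zero_or_one A hA hinv := by
    rw [Measure.map_apply measurable_swap hA]
    refine herg.zero_or_one _ (measurable_swap hA) fun t => ?_
    change Prod.swap ⁻¹' (diagonalFlow Γ t ⁻¹' A) = _
    rw [hinv]

/-- The vertical flow at time `t` is the horizontal flow at time `-t` followed by the diagonal flow
at time `t`. -/
lemma measurePreserving_verticalFlow_of_swap {μ : Measure (X Γ × X Γ)}
    (h : ∀ t, MeasurePreserving (diagonalFlow Γ t) μ μ)
    (hs : ∀ t, MeasurePreserving (verticalFlow Γ t) (μ.map Prod.swap) (μ.map Prod.swap)) (t : ℝ) :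
    MeasurePreserving (verticalFlow Γ t) μ μ := by
  have hswap : MeasurePreserving Prod.swap μ (μ.map Prod.swap) := ⟨measurable_swap, rfl⟩
  have hswap' : MeasurePreserving Prod.swap (μ.map Prod.swap) μ := by
    refine ⟨measurable_swap, ?_⟩
    rw [Measure.map_map measurable_swap measurable_swap, Prod.swap_swap_eq, Measure.map_id]
  have hcomp := (h t).comp (hswap'.comp ((hs (-t)).comp hswap))
  convert hcomp using 1
  funext p
  refine Prod.ext ?_ rfl
  change p.1 = horocycleFlow Γ t (horocycleFlow Γ (-t) p.1)
  rw [← isMeasurableFlow_horocycleFlow.map_add, add_neg_cancel,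
    isMeasurableFlow_horocycleFlow.map_zero]

/-- An ergodic self-joining that is not invariant under the vertical flow has finite fibres. -/
theorem IsSelfJoining.hasFiniteFibers {hΓ : IsLattice Γ} {μ : Measure (X Γ × X Γ)}
    (hμ : IsSelfJoining hΓ μ) (herg : IsErgodicFlow (diagonalFlow Γ) μ)
    (hinv : ¬ ∀ t, MeasurePreserving (verticalFlow Γ t) μ μ) : HasFiniteFibers μ := by
  obtain ⟨Ω, hΩ, hΩμ, hfin⟩ := hμ.exists_finite_fibers herg hinv
  obtain ⟨Ω', hΩ', hΩμ', hfin'⟩ := hμ.swap.exists_finite_fibers herg.swap fun h =>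
    hinv (measurePreserving_verticalFlow_of_swap hμ.invariant h)
  rw [Measure.map_apply measurable_swap hΩ'.compl] at hΩμ'
  refine ⟨Ω ∩ Prod.swap ⁻¹' Ω', hΩ.inter (measurable_swap hΩ'), ?_, fun x =>
    ⟨(hfin x).subset fun y hy => hy.1, (hfin' x).subset fun y hy => hy.2⟩⟩
  rw [Set.compl_inter]
  exact measure_union_null hΩμ hΩμ'

end FiniteFibers

end Horocycle

end

theorem mainTheorem6 (Γ : Subgroup Horocycle.G) (hΓ : Horocycle.IsLattice Γ)
    (μ : MeasureTheory.Measure (Horocycle.X Γ × Horocycle.X Γ))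
    (hμ : Horocycle.IsSelfJoining hΓ μ)
    (herg : Horocycle.IsErgodicFlow (Horocycle.diagonalFlow Γ) μ) :
    (μ = (Horocycle.haarProb hΓ).prod (Horocycle.haarProb hΓ) ∨ Horocycle.HasFiniteFibers μ) ∧
      ((∀ t, MeasureTheory.MeasurePreserving (Horocycle.verticalFlow Γ t) μ μ) →
        μ = (Horocycle.haarProb hΓ).prod (Horocycle.haarProb hΓ)) ∧
      ((¬ ∀ t, MeasureTheory.MeasurePreserving (Horocycle.verticalFlow Γ t) μ μ) →
        Horocycle.HasFiniteFibers μ) := by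
  refine ⟨?_, hμ.eq_prod herg, hμ.hasFiniteFibers herg⟩
  by_cases h : ∀ t, MeasureTheory.MeasurePreserving (Horocycle.verticalFlow Γ t) μ μ
  · exact Or.inl (hμ.eq_prod herg h)
  · exact Or.inr (hμ.hasFiniteFibers herg h)
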